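/- Let $P_n$ be the path on $n\ge 1$ vertices. A sequence of vertices $x_1,x_2,\ldots$ of a finite graph $G=(V,E)$ determines a burning process: at time $0$ no vertex burns; in each round $t\ge 1$ every vertex with a neighbour burning at the end of round $t-1$ starts burning, $x_t$ starts burning, and burning vertices keep burning. The burning number $b(G)$ is the minimum number of rounds after which all vertices can be burning when in each round $x_t$ is a vertex not burning at the moment of selection, as long as there is such a vertex. Consider three random choices of $(x_t)_{t\ge1}$: given $x_1,\ldots,x_{t-1}$, the vertex $x_t$ is uniformly distributed on 1. $V$; 2. the set of vertices not in $\{x_1,\ldots,x_{t-1}\}$; 3. the set of vertices that are not burning at the moment of selection (an arbitrary vertex if this set is empty; this does not affect what follows). Let $b_j(G)$ ($j=1,2,3$) be the first time at which all vertices are burning in the $j$-th process, and, for $G = P_n$, $c_j(P_n)=b_j(P_n)/b(P_n)$. The selection in round $t$ may be taken to happen before, or after, the fire spreads in that round; the theorem holds under either convention. The three processes on $P_n$ may be defined on any common probability space. A sequence of events holds asymptotically almost surely (a.a.s.) if its probability tends to $1$ as $n\to\infty$; "a.a.s. $A_n=(1+o(1))B_n$" means that for every $\varepsilon>0$ a.a.s.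 $|A_n-B_n|\le\varepsilon B_n$; "a.a.s. $A_n=\Theta(B_n)$" means that there are constants $c,C>0$ such that a.a.s. $cB_n\le A_n\le CB_n$. **Theorem 1.4.** A.a.s. the following holds: (i) $b_1(P_n)=(1+o(1))\,b_2(P_n)=(1+o(1))\sqrt{n\log n/2}$, and thus $c_1(P_n)=(1+o(1))\,c_2(P_n)=(1+o(1))\sqrt{\log n/2}$; (ii) $b_3(P_n)=\Theta(\sqrt n)$, and thus $c_3(P_n)=\Theta(1)$. -/

import Mathlib

open MeasureTheory ProbabilityTheory Filter Topology

namespace Burning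

noncomputable section

/-! Throughout, a sequence of selected vertices is indexed from `0`: `x i` is the vertex selected
in round `i + 1` of the process. -/

section Selection

variable {V : Type*}

/-- One round of spreading: all vertices of `B` together with all their neighbours. -/
def spread (G : SimpleGraph V) (B : Set V) : Set V :=
  B ∪ {v | ∃ u ∈ B, G.Adj u v}

/-- The set of vertices burning at the end of round `t` when the vertices `x 0, x 1, …` are
selected in rounds `1, 2, …`. In round `t + 1` the fire spreads from the vertices that were burning
at the end of round `t`, and the selected vertex `x t` starts burning. -/
def burning (G : SimpleGraph V) (x : ℕ → V) : ℕ → Set V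
  | 0 => ∅
  | t + 1 => insert (x t) (spread G (burning G x t))

/-- The first time at which all vertices are burning. (If `G` is finite and connected, such a time
exists for every `x`.) -/
def burningTime (G : SimpleGraph V) (x : ℕ → V) : ℕ :=
  sInf {t | burning G x t = Set.univ}

/-- The two ways to read "not burning when the vertex of this round is selected": the selection is
made before, or after, the fire spreads in that round. -/
inductive Timing
  | beforeSpread
  | afterSpread

/-- The vertices that are not burning when the vertex `x t` of round `t + 1` is to be selected. -/
def unburnt (s : Timing) (G : SimpleGraph V) (x : ℕ → V) (t : ℕ) : Set V :=
  match s with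
  | Timing.beforeSpread => (burning G x t)ᶜ
  | Timing.afterSpread => (spread G (burning G x t))ᶜ

/-- A legal sequence of the deterministic burning process: in every round an unburnt vertex is
selected, if there is one. -/
def IsLegal (s : Timing) (G : SimpleGraph V) (x : ℕ → V) : Prop :=
  ∀ t, (unburnt s G x t).Nonempty → x t ∈ unburnt s G x t

/-- The burning number: the minimum number of rounds in which a legal sequence burns all
vertices. -/
def burningNumber (s : Timing) (G : SimpleGraph V) : ℕ :=
  sInf {k | ∃ x, IsLegal s G x ∧ burning G x k = Set.univ}

/-- The set from which the vertex `x t` of round `t + 1` is selected uniformly at random, for the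
first process: all vertices. -/
def pool₁ (_x : ℕ → V) (_t : ℕ) : Set V := Set.univ

/-- The same for the second process: the vertices not selected before. -/
def pool₂ (x : ℕ → V) (t : ℕ) : Set V := {v | ∀ i < t, x i ≠ v}

/-- The same for the third process: the vertices that are not burning. -/
def pool₃ (s : Timing) (G : SimpleGraph V) (x : ℕ → V) (t : ℕ) : Set V := unburnt s G x t

open Classical in
/-- The law of the next selected vertex: uniform on the pool. Once the pool is empty, which happens
only when all vertices are burning or are about to burn in this round by spreading, so that the
selection is irrelevant, we let it be uniform on all vertices. -/
def stepLaw [MeasurableSpace V] (pool : (ℕ → V) → ℕ → Set V) (x : ℕ → V) (t : ℕ) : Measure V :=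
  uniformOn (if (pool x t).Nonempty then pool x t else Set.univ)

/-- Extend a finite history `h 0, …, h n` to an infinite sequence (in an irrelevant way). -/
def extendHistory (n : ℕ) (h : Finset.Iic n → V) : ℕ → V :=
  fun i => h ⟨min i n, Finset.mem_Iic.2 (min_le_right i n)⟩

section Law

variable [Finite V] [Nonempty V] [MeasurableSpace V] [MeasurableSingletonClass V]

instance stepLaw_isProbabilityMeasure (pool : (ℕ → V) → ℕ → Set V) (x : ℕ → V) (t : ℕ) :
    IsProbabilityMeasure (stepLaw pool x t) := by
  unfold stepLaw
  split_ifs with h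
  · exact isProbabilityMeasure_uniformOn (Set.toFinite _) h
  · exact isProbabilityMeasure_uniformOn (Set.toFinite _) Set.univ_nonempty

/-- The transition kernel: given the selections `h 0, …, h n` of the first `n + 1` rounds, the
law of the selection of the next round. -/
def stepKernel (pool : (ℕ → V) → ℕ → Set V) (n : ℕ) : Kernel (Finset.Iic n → V) V :=
  Kernel.ofFunOfCountable fun h => stepLaw pool (extendHistory n h) (n + 1)

instance stepKernel_isMarkovKernel (pool : (ℕ → V) → ℕ → Set V) (n : ℕ) :
    IsMarkovKernel (stepKernel pool n) :=
  ⟨fun h => stepLaw_isProbabilityMeasure pool (extendHistory n h) (n + 1)⟩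

/-- The law of the infinite random sequence of selected vertices, in which the vertex of each round
is selected, given all earlier selections, uniformly at random from the pool of that round. -/
def processLaw (pool : (ℕ → V) → ℕ → Set V) : Measure (ℕ → V) :=
  Kernel.trajMeasure (X := fun _ => V) (stepLaw pool (fun _ => Classical.arbitrary V) 0)
    (stepKernel pool)

end Law

end Selection

section Asymptotics

variable {Ω : ℕ → Type*} [∀ n, MeasurableSpace (Ω n)]

/-- The events `E n` hold asymptotically almost surely. -/
def AAS (P : ∀ n, Measure (Ω n)) (E : ∀ n, Set (Ω n)) : Prop :=
  Tendsto (fun n => P n (E n)) atTop (𝓝 1)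

/-- A.a.s. `A = (1 + o(1)) B`. -/
def AASEquiv (P : ∀ n, Measure (Ω n)) (A B : ∀ n, Ω n → ℝ) : Prop :=
  ∀ ε : ℝ, 0 < ε → AAS P fun n => {ω | |A n ω - B n ω| ≤ ε * B n ω}

/-- A.a.s. `A = Θ(B)`. -/
def AASTheta (P : ∀ n, Measure (Ω n)) (A B : ∀ n, Ω n → ℝ) : Prop :=
  ∃ c C : ℝ, 0 < c ∧ 0 < C ∧ AAS P fun n => {ω | c * B n ω ≤ A n ω ∧ A n ω ≤ C * B n ω}

end Asymptotics

/-- The first time all vertices of the path on `n + 1` vertices are burning, for the random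
sequence `X n` of selected vertices. -/
def bPath {Ω : ℕ → Type*} (X : ∀ n, Ω n → ℕ → Fin (n + 1)) (n : ℕ) (ω : Ω n) : ℝ :=
  (burningTime (SimpleGraph.pathGraph (n + 1)) (X n ω) : ℝ)

/-- The cost of drunkenness of the path on `n + 1` vertices. -/
def cPath {Ω : ℕ → Type*} (s : Timing) (X : ∀ n, Ω n → ℕ → Fin (n + 1)) (n : ℕ) (ω : Ω n) : ℝ :=
  bPath X n ω / (burningNumber s (SimpleGraph.pathGraph (n + 1)) : ℝ)

end

end Burning

/-! Write `N = n + 1`. A vertex `v` survives `T` rounds exactly when, for every `i < T`, the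
selection `x i` misses the ball of radius `T - 1 - i` around `v` (`mem_burning_iff`). If all earlier
selections have missed, the next ball lies entirely inside the pool under each of the three rules
(`IsBallPool`). Hence the conditional probability of a hit is ball size over pool size, and
multiplying over rounds bounds the survival probabilities (`processLaw_real_inter_avoid_le`,
`le_processLaw_real_avoid`).

For an interior vertex the ball sizes `2 k + 1` sum to `T²`, so survival has probability at most
`exp (-T² / N)`. In the first two processes the pool loses at most one vertex per round, which gives
the lower bound `exp (-T² / (N - 3 T))`. At `T ≈ √(N log N / 2)` both are about `N ^ (-1/2)`. For
the upper bound on the burning time, a union bound over all vertices would be too expensive; an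
`L`-net with `L` of order `ε T` has only order `√(N / log N)` interior points, and `L` further
rounds burn everything between them (`processLaw_real_burning_ne_univ_le`). Near the ends survival
is likelier, but boundedly many net points lie there. For the lower bound, a second moment argument
is applied to order `√(N / log N)` vertices with disjoint `T`-balls
(`processLaw_real_burning_eq_univ_le`); it works because `T³ / N²` tends to `0`, which makes
survival of two such vertices nearly uncorrelated.

In the third process the pool shrinks with the fire, which removes the logarithm. A phase of `80 τ +
1` rounds brings the number of unburnt vertices from `(2 τ)²` to `τ²`, except with probability
exponentially small in `τ` (`processLaw_real_phase_le`). Phase lengths form a geometric series of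
total order `√N`, and phases stop at `τ ≈ N ^ (1/4)`, where the remaining `O(√N)` vertices burn by
spreading alone. Deterministically at least `√N` rounds are needed, and the burning number lies
between `√N` and `√N + 1`, which transfers the results to the cost of drunkenness. -/

namespace Burning

/-! ### Conditional probabilities under the law of the selection process -/

section Law

variable {V : Type*}

/-- A set of sequences that is determined by the entries with index less than `t`. -/
def DeterminedBefore (E : Set (ℕ → V)) (t : ℕ) : Prop :=
  ∀ x y : ℕ → V, (∀ i < t, x i = y i) → x ∈ E → y ∈ E

/-- A pool that is determined by the earlier selections. -/
def IsLocal (pool : (ℕ → V) → ℕ → Set V) : Prop :=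
  ∀ x y t, (∀ i < t, x i = y i) → pool x t = pool y t

/-- The sequences that avoid `B i` at all times `i` with `s ≤ i < t`. -/
def avoid (B : ℕ → Set V) (s t : ℕ) : Set (ℕ → V) :=
  {x | ∀ i, s ≤ i → i < t → x i ∉ B i}

lemma DeterminedBefore.inter {E F : Set (ℕ → V)} {t : ℕ} (hE : DeterminedBefore E t)
    (hF : DeterminedBefore F t) : DeterminedBefore (E ∩ F) t :=
  fun x y h hx => ⟨hE x y h hx.1, hF x y h hx.2⟩

lemma DeterminedBefore.mono {E : Set (ℕ → V)} {s t : ℕ} (hE : DeterminedBefore E s)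
    (h : s ≤ t) : DeterminedBefore E t :=
  fun x y hxy => hE x y fun i hi => hxy i (hi.trans_le h)

lemma determinedBefore_univ (t : ℕ) : DeterminedBefore (Set.univ : Set (ℕ → V)) t :=
  fun _ _ _ _ => trivial

lemma determinedBefore_avoid (B : ℕ → Set V) (s t : ℕ) : DeterminedBefore (avoid B s t) t := by
  intro x y h hx i hs ht
  rw [← h i ht]
  exact hx i hs ht

lemma avoid_succ (B : ℕ → Set V) {s t : ℕ} (h : s ≤ t) :
    avoid B s (t + 1) = avoid B s t ∩ {x | x t ∈ (B t)ᶜ} := by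
  ext x
  simp only [avoid, Set.mem_ofPred_eq, Set.mem_inter_iff, Set.mem_compl_iff]
  constructor
  · exact fun hx => ⟨fun i hi hit => hx i hi (by omega), hx t h (by omega)⟩
  · rintro ⟨h1, h2⟩ i hi hit
    rcases Nat.lt_succ_iff_lt_or_eq.1 hit with h | rfl
    · exact h1 i hi h
    · exact h2

lemma avoid_self (B : ℕ → Set V) (s : ℕ) : avoid B s s = Set.univ := by
  ext x
  simp only [avoid, Set.mem_ofPred_eq, Set.mem_univ, iff_true]
  intro i h1 h2
  omega

lemma stepLaw_congr [MeasurableSpace V] {pool : (ℕ → V) → ℕ → Set V} (hp : IsLocal pool)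
    {x y : ℕ → V} {t : ℕ} (h : ∀ i < t, x i = y i) : stepLaw pool x t = stepLaw pool y t := by
  unfold stepLaw
  rw [hp x y t h]

lemma extendHistory_frestrictLe (n : ℕ) (x : ℕ → V) (i : ℕ) (hi : i < n + 1) :
    extendHistory n (Preorder.frestrictLe (π := fun _ => V) n x) i = x i := by
  simp only [extendHistory, Preorder.frestrictLe_apply]
  congr 1
  omega

lemma DeterminedBefore.eq_preimage {E : Set (ℕ → V)} {n : ℕ} (hE : DeterminedBefore E (n + 1)) :
    E = Preorder.frestrictLe (π := fun _ => V) n ⁻¹' {h | extendHistory n h ∈ E} := by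
  ext x
  exact ⟨hE _ _ fun i hi => (extendHistory_frestrictLe n x i hi).symm,
    hE _ _ fun i hi => extendHistory_frestrictLe n x i hi⟩

/-- A nonempty `B` inside the pool excludes the fallback branch of `stepLaw`, so the law is uniform
on the pool. -/
lemma stepLaw_real_of_subset [Finite V] [MeasurableSpace V] [MeasurableSingletonClass V]
    {pool : (ℕ → V) → ℕ → Set V} {x : ℕ → V} {t : ℕ} {B : Set V}
    (hB : B ⊆ pool x t) (hne : B.Nonempty) :
    (stepLaw pool x t).real B = B.ncard / (pool x t).ncard := by
  classical
  have := Fintype.ofFinite V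
  unfold stepLaw
  rw [if_pos (hne.mono hB), measureReal_def, ← Set.coe_toFinset B, ← Set.coe_toFinset (pool x t),
    uniformOn_apply_finset, Set.ncard_coe_finset, Set.ncard_coe_finset,
    Finset.inter_eq_right.2 (by simpa using hB), ENNReal.toReal_div]
  simp

lemma DeterminedBefore.measurableSet [Finite V] [MeasurableSpace V]
    [MeasurableSingletonClass V] {E : Set (ℕ → V)} {t : ℕ} (hE : DeterminedBefore E t) :
    MeasurableSet E := by
  rw [(hE.mono (Nat.le_succ t)).eq_preimage]
  exact Preorder.measurable_frestrictLe _ (Set.toFinite _).measurableSet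

variable [Finite V] [Nonempty V] [MeasurableSpace V] [MeasurableSingletonClass V]

instance (pool : (ℕ → V) → ℕ → Set V) : IsProbabilityMeasure (processLaw pool) := by
  unfold processLaw
  infer_instance

lemma processLaw_map_zero (pool : (ℕ → V) → ℕ → Set V) :
    (processLaw pool).map (fun x => x 0) =
      stepLaw pool (fun _ => Classical.arbitrary V) 0 := by
  have h : (fun x : ℕ → V => x 0) =
      (MeasurableEquiv.piUnique (fun _ : Finset.Iic 0 => V)) ∘
        Preorder.frestrictLe (π := fun _ => V) 0 := by
    ext x; rfl
  unfold processLaw Kernel.trajMeasure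
  rw [h, ← Measure.map_map (by fun_prop) (by fun_prop), Measure.map_comp _ _ (by fun_prop),
    Kernel.traj_map_frestrictLe, Kernel.partialTraj_self, Measure.id_comp,
    Measure.map_map (by fun_prop) (by fun_prop), MeasurableEquiv.self_comp_symm, Measure.map_id]

/-- The defining property of the law in usable form: given the first `t` selections, the next one
follows `stepLaw`. Locality makes the arbitrary tail added by `extendHistory` harmless. -/
lemma processLaw_inter_eq {pool : (ℕ → V) → ℕ → Set V} (hp : IsLocal pool) {E : Set (ℕ → V)}
    {t : ℕ} (hE : DeterminedBefore E t) (B : Set V) :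
    processLaw pool (E ∩ {x | x t ∈ B}) = ∫⁻ x in E, stepLaw pool x t B ∂(processLaw pool) := by
  have hB : MeasurableSet B := (Set.toFinite B).measurableSet
  rcases t with _ | n
  · have hc : ∀ x, stepLaw pool x 0 = stepLaw pool (fun _ => Classical.arbitrary V) 0 :=
      fun x => stepLaw_congr hp (by simp)
    simp only [hc, lintegral_const, Measure.restrict_apply_univ]
    -- An event determined before time `0` is empty or everything.
    rcases Set.eq_empty_or_nonempty E with rfl | ⟨y, hy⟩
    · simp
    · have : E = Set.univ := Set.eq_univ_of_forall fun z => hE y z (by simp) hy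
      rw [this, Set.univ_inter, measure_univ, mul_one, ← processLaw_map_zero,
        Measure.map_apply (by fun_prop) hB]
      rfl
  · have hEE := hE.eq_preimage
    set E' : Set (Finset.Iic n → V) := {h | extendHistory n h ∈ E} with hE'
    have hE'm : MeasurableSet E' := (Set.toFinite _).measurableSet
    have h1 : E ∩ {x | x (n + 1) ∈ B} =
        (fun x : ℕ → V => (Preorder.frestrictLe (π := fun _ => V) n x, x (n + 1))) ⁻¹'
          (E' ×ˢ B) := by
      rw [hEE]; rfl
    rw [h1, ← Measure.map_apply (by fun_prop) (hE'm.prod hB)]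
    unfold processLaw
    rw [← Kernel.map_frestrictLe_trajMeasure_compProd_eq_map_trajMeasure,
      Measure.compProd_apply_prod hE'm hB, setLIntegral_map hE'm
        (Kernel.measurable_coe _ hB) (by fun_prop), ← hEE]
    refine lintegral_congr fun x => ?_
    change stepLaw pool _ _ B = _
    rw [stepLaw_congr hp (extendHistory_frestrictLe n x)]

lemma stepLaw_real_compl (pool : (ℕ → V) → ℕ → Set V) (x : ℕ → V) (t : ℕ) (B : Set V) :
    (stepLaw pool x t).real Bᶜ = 1 - (stepLaw pool x t).real B :=
  probReal_compl_eq_one_sub (Set.toFinite B).measurableSet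

lemma processLaw_real_inter_compl_le {pool : (ℕ → V) → ℕ → Set V} (hp : IsLocal pool)
    {E : Set (ℕ → V)} {t : ℕ} (hE : DeterminedBefore E t) {B : Set V} {q : ℝ}
    (hq : ∀ x ∈ E, q ≤ (stepLaw pool x t).real B) :
    (processLaw pool).real (E ∩ {x | x t ∈ Bᶜ}) ≤ (1 - q) * (processLaw pool).real E := by
  rcases Set.eq_empty_or_nonempty E with rfl | ⟨y, hy⟩
  · simp
  have hq1 : 0 ≤ 1 - q := sub_nonneg.2 ((hq y hy).trans measureReal_le_one)
  have h : processLaw pool (E ∩ {x | x t ∈ Bᶜ}) ≤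
      ENNReal.ofReal (1 - q) * processLaw pool E := by
    rw [processLaw_inter_eq hp hE, ← setLIntegral_const]
    refine setLIntegral_mono measurable_const fun x hx => ?_
    rw [← ofReal_measureReal, stepLaw_real_compl]
    exact ENNReal.ofReal_le_ofReal (by linarith [hq x hx])
  have := ENNReal.toReal_mono (by finiteness) h
  rwa [ENNReal.toReal_mul, ENNReal.toReal_ofReal hq1] at this

lemma le_processLaw_real_inter_compl {pool : (ℕ → V) → ℕ → Set V} (hp : IsLocal pool)
    {E : Set (ℕ → V)} {t : ℕ} (hE : DeterminedBefore E t) {B : Set V} {q : ℝ}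
    (hq : ∀ x ∈ E, (stepLaw pool x t).real B ≤ q) (hq1 : q ≤ 1) :
    (1 - q) * (processLaw pool).real E ≤ (processLaw pool).real (E ∩ {x | x t ∈ Bᶜ}) := by
  have h : ENNReal.ofReal (1 - q) * processLaw pool E ≤
      processLaw pool (E ∩ {x | x t ∈ Bᶜ}) := by
    rw [processLaw_inter_eq hp hE, ← setLIntegral_const]
    refine setLIntegral_mono' hE.measurableSet fun x hx => ?_
    rw [← ofReal_measureReal (μ := stepLaw pool x t), stepLaw_real_compl]
    exact ENNReal.ofReal_le_ofReal (by linarith [hq x hx])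
  have := ENNReal.toReal_mono (by finiteness) h
  rwa [ENNReal.toReal_mul, ENNReal.toReal_ofReal (by linarith)] at this

/-- If in each round `i` with `s ≤ i < T` the set `B i` is hit with conditional probability at
least `q i`, then all these sets are missed with probability at most `exp (- ∑ q i)`. -/
lemma processLaw_real_inter_avoid_le {pool : (ℕ → V) → ℕ → Set V} (hp : IsLocal pool)
    {E : Set (ℕ → V)} {s T : ℕ} (hE : DeterminedBefore E s) (hsT : s ≤ T) {B : ℕ → Set V}
    {q : ℕ → ℝ}
    (hq : ∀ t, s ≤ t → t < T → ∀ x ∈ E ∩ avoid B s t, q t ≤ (stepLaw pool x t).real (B t)) :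
    (processLaw pool).real (E ∩ avoid B s T) ≤
      Real.exp (-∑ i ∈ Finset.Ico s T, q i) * (processLaw pool).real E := by
  induction T, hsT using Nat.le_induction with
  | base => simp [avoid_self]
  | succ T hsT ih =>
    have ih := ih fun t h1 h2 => hq t h1 (by omega)
    rw [avoid_succ B hsT, ← Set.inter_assoc, Finset.sum_Ico_succ_top hsT, neg_add, Real.exp_add]
    refine (processLaw_real_inter_compl_le hp
      ((hE.mono hsT).inter (determinedBefore_avoid B s T)) (hq T hsT (by omega))).trans ?_
    calc (1 - q T) * (processLaw pool).real (E ∩ avoid B s T)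
        ≤ Real.exp (-q T) * (processLaw pool).real (E ∩ avoid B s T) :=
          mul_le_mul_of_nonneg_right (Real.one_sub_le_exp_neg _) measureReal_nonneg
      _ ≤ Real.exp (-q T) * (Real.exp (-∑ i ∈ Finset.Ico s T, q i) * (processLaw pool).real E) :=
          mul_le_mul_of_nonneg_left ih (Real.exp_nonneg _)
      _ = _ := by ring

/-- If in each round `i < T` the set `B i` is hit with conditional probability at most `q i`,
then all these sets are missed with probability at least `∏ (1 - q i)`. -/
lemma le_processLaw_real_avoid {pool : (ℕ → V) → ℕ → Set V} (hp : IsLocal pool) {T : ℕ}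
    {B : ℕ → Set V} {q : ℕ → ℝ}
    (hq : ∀ t < T, ∀ x ∈ avoid B 0 t, (stepLaw pool x t).real (B t) ≤ q t)
    (hq1 : ∀ t < T, q t ≤ 1) :
    ∏ i ∈ Finset.range T, (1 - q i) ≤ (processLaw pool).real (avoid B 0 T) := by
  induction T with
  | zero => simp [avoid_self]
  | succ T ih =>
    have ih := ih (fun t h => hq t (by omega)) fun t h => hq1 t (by omega)
    rw [avoid_succ B (Nat.zero_le T), Finset.prod_range_succ, mul_comm]
    exact (mul_le_mul_of_nonneg_left ih (by linarith [hq1 T (by omega)])).trans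
      (le_processLaw_real_inter_compl hp (determinedBefore_avoid B 0 T) (hq T (by omega))
        (hq1 T (by omega)))

end Law

/-! ### Balls in the path, burning, and the ball property of the three pools -/

section Path

variable {n : ℕ}

/-- The ball of radius `k` around `v` in the path. -/
def near (k : ℕ) (v : Fin (n + 1)) : Finset (Fin (n + 1)) :=
  Finset.univ.filter fun w => w.val ≤ v.val + k ∧ v.val ≤ w.val + k

@[simp] lemma mem_near {k : ℕ} {v w : Fin (n + 1)} :
    w ∈ near k v ↔ w.val ≤ v.val + k ∧ v.val ≤ w.val + k := by
  simp [near]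

lemma near_eq_Icc_interior {k : ℕ} {v : Fin (n + 1)} (h1 : k ≤ v) (h2 : v + k ≤ n) :
    near k v = Finset.Icc ⟨v - k, by omega⟩ ⟨v + k, by omega⟩ := by
  ext w
  simp only [mem_near, Finset.mem_Icc, Fin.le_def]
  omega

lemma card_near_interior {k : ℕ} {v : Fin (n + 1)} (h1 : k ≤ v) (h2 : v + k ≤ n) :
    (near k v).card = 2 * k + 1 := by
  rw [near_eq_Icc_interior h1 h2, Fin.card_Icc]
  simp only
  omega

lemma succ_le_card_near {k : ℕ} (hk : k ≤ n) (v : Fin (n + 1)) : k + 1 ≤ (near k v).card := by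
  by_cases h : k ≤ v
  · have : Finset.Icc ⟨v - k, by omega⟩ v ⊆ near k v := by
      intro w hw
      simp only [mem_near, Finset.mem_Icc, Fin.le_def] at *
      omega
    refine le_trans ?_ (Finset.card_le_card this)
    rw [Fin.card_Icc]
    simp only
    omega
  · have : Finset.Icc ⟨0, by omega⟩ ⟨k, by omega⟩ ⊆ near k v := by
      intro w hw
      simp only [mem_near, Finset.mem_Icc, Fin.le_def] at *
      omega
    refine le_trans ?_ (Finset.card_le_card this)
    rw [Fin.card_Icc]
    simp only
    omega

lemma card_near_le (k : ℕ) (v : Fin (n + 1)) : (near k v).card ≤ 2 * k + 1 := by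
  have : near k v ⊆ Finset.Icc ⟨v - k, by omega⟩ ⟨min (v + k) n, by omega⟩ := by
    intro w hw
    simp only [mem_near, Finset.mem_Icc, Fin.le_def] at *
    omega
  refine (Finset.card_le_card this).trans ?_
  rw [Fin.card_Icc]
  simp only
  omega

lemma self_mem_near (k : ℕ) (v : Fin (n + 1)) : v ∈ near k v := by simp

/-- A vertex of the path burns after `t` rounds if it is close enough to a selected vertex. -/
lemma mem_burning_iff (x : ℕ → Fin (n + 1)) (t : ℕ) (v : Fin (n + 1)) :
    v ∈ burning (SimpleGraph.pathGraph (n + 1)) x t ↔ ∃ i < t, x i ∈ near (t - 1 - i) v := by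
  induction t generalizing v with
  | zero => simp [burning]
  | succ t ih =>
    simp only [burning, Set.mem_insert_iff, spread, Set.mem_union, Set.mem_ofPred_eq, ih,
      SimpleGraph.pathGraph_adj, mem_near]
    constructor
    · rintro (rfl | ⟨i, hi, h⟩ | ⟨u, ⟨i, hi, h⟩, hu⟩)
      · exact ⟨t, by omega, by omega⟩
      · exact ⟨i, by omega, by omega⟩
      · exact ⟨i, by omega, by omega⟩
    · rintro ⟨i, hi, h⟩
      rcases Nat.lt_succ_iff_lt_or_eq.1 hi with hi | rfl
      · right
        by_cases h2 : (x i).val ≤ v.val + (t - 1 - i) ∧ v.val ≤ (x i).val + (t - 1 - i)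
        · exact Or.inl ⟨i, hi, h2⟩
        · right
          rcases lt_or_ge (x i).val v.val with h3 | h3
          · exact ⟨⟨v.val - 1, by omega⟩, ⟨i, hi, by simp only; omega⟩, by simp only; omega⟩
          · exact ⟨⟨v.val + 1, by omega⟩, ⟨i, hi, by simp only; omega⟩, Or.inr rfl⟩
      · left
        apply Fin.ext
        omega

lemma burning_mono (x : ℕ → Fin (n + 1)) {s t : ℕ} (h : s ≤ t) :
    burning (SimpleGraph.pathGraph (n + 1)) x s ⊆ burning (SimpleGraph.pathGraph (n + 1)) x t := by
  intro v
  simp only [mem_burning_iff, mem_near]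
  rintro ⟨i, hi, h⟩
  exact ⟨i, by omega, by omega⟩

/-- If `v` does not burn `r` rounds later, then the ball of radius `r` around `v` is unburnt. -/
lemma not_mem_burning_of_mem_near {x : ℕ → Fin (n + 1)} {t r : ℕ} {v w : Fin (n + 1)}
    (hv : v ∉ burning (SimpleGraph.pathGraph (n + 1)) x (t + r)) (hw : w ∈ near r v) :
    w ∉ burning (SimpleGraph.pathGraph (n + 1)) x t := by
  rw [mem_burning_iff] at *
  rintro ⟨i, hi, h⟩
  refine hv ⟨i, by omega, ?_⟩
  rw [mem_near] at *
  omega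

lemma burning_eq_univ_of_lt (x : ℕ → Fin (n + 1)) {t : ℕ} (ht : n < t) :
    burning (SimpleGraph.pathGraph (n + 1)) x t = Set.univ := by
  refine Set.eq_univ_of_forall fun v => (mem_burning_iff x t v).2 ⟨0, by omega, ?_⟩
  rw [mem_near]
  omega

lemma burning_burningTime (x : ℕ → Fin (n + 1)) :
    burning (SimpleGraph.pathGraph (n + 1)) x
      (burningTime (SimpleGraph.pathGraph (n + 1)) x) = Set.univ :=
  Nat.sInf_mem (s := {t | burning (SimpleGraph.pathGraph (n + 1)) x t = Set.univ})
    ⟨n + 1, burning_eq_univ_of_lt x (by omega)⟩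

lemma burningTime_le_iff (x : ℕ → Fin (n + 1)) (t : ℕ) :
    burningTime (SimpleGraph.pathGraph (n + 1)) x ≤ t ↔
      burning (SimpleGraph.pathGraph (n + 1)) x t = Set.univ := by
  refine ⟨fun h => ?_, fun h => Nat.sInf_le h⟩
  have := burning_mono x h
  rw [burning_burningTime] at this
  exact Set.eq_univ_of_univ_subset this

/-- In `t` rounds at most `t ^ 2` vertices of a path can be burnt. -/
lemma le_sq_of_burning_eq_univ {x : ℕ → Fin (n + 1)} {t : ℕ}
    (h : burning (SimpleGraph.pathGraph (n + 1)) x t = Set.univ) : n + 1 ≤ t ^ 2 := by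
  have h1 : (Finset.univ : Finset (Fin (n + 1))) ⊆
      (Finset.range t).biUnion fun i => near (t - 1 - i) (x i) := by
    intro v _
    obtain ⟨i, hi, hv⟩ := (mem_burning_iff x t v).1 (h ▸ Set.mem_univ v)
    refine Finset.mem_biUnion.2 ⟨i, Finset.mem_range.2 hi, ?_⟩
    rw [mem_near] at *
    omega
  have h2 := (Finset.card_le_card h1).trans (Finset.card_biUnion_le.trans
    (Finset.sum_le_sum fun i _ => card_near_le (t - 1 - i) (x i)))
  rw [Finset.card_univ, Fintype.card_fin,
    Finset.sum_range_reflect (fun i => 2 * i + 1) t] at h2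
  refine h2.trans (le_of_eq ?_)
  clear h h1 h2
  induction t with
  | zero => simp
  | succ t ih => rw [Finset.sum_range_succ, ih]; ring

lemma le_sq_burningTime (x : ℕ → Fin (n + 1)) :
    n + 1 ≤ burningTime (SimpleGraph.pathGraph (n + 1)) x ^ 2 :=
  le_sq_of_burning_eq_univ (burning_burningTime x)

lemma burning_congr {V : Type*} (G : SimpleGraph V) {x y : ℕ → V} {t : ℕ}
    (h : ∀ i < t, x i = y i) : burning G x t = burning G y t := by
  induction t with
  | zero => rfl
  | succ t ih =>
    rw [burning, burning, ih fun i hi => h i (by omega), h t (by omega)]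

lemma unburnt_subset (s : Timing) {V : Type*} (G : SimpleGraph V) (x : ℕ → V) (t : ℕ) :
    unburnt s G x t ⊆ (burning G x t)ᶜ := by
  cases s
  · exact subset_rfl
  · exact Set.compl_subset_compl.2 Set.subset_union_left

/-- A pool determined by the earlier selections that contains every ball that a future fire must
meet in order to reach, by a given time `T`, a vertex which the earlier fires do not reach. -/
structure IsBallPool (pool : (ℕ → Fin (n + 1)) → ℕ → Set (Fin (n + 1))) : Prop where
  isLocal : IsLocal pool
  subset : ∀ x v T t, t < T → (∀ i < t, x i ∉ near (T - 1 - i) v) →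
    (near (T - 1 - t) v : Set (Fin (n + 1))) ⊆ pool x t

lemma isBallPool_pool₁ : IsBallPool (n := n) pool₁ :=
  ⟨fun _ _ _ _ => rfl, fun _ _ _ _ _ _ => Set.subset_univ _⟩

/-- The balls shrink with time, so a vertex of the current ball that had been selected earlier would
have hit the larger ball of its own round. -/
lemma isBallPool_pool₂ : IsBallPool (n := n) pool₂ := by
  refine ⟨fun x y t h => ?_, fun x v T t ht h w hw i hi he => h i hi ?_⟩
  · ext v
    simp only [pool₂, Set.mem_ofPred_eq]
    exact forall₂_congr fun i hi => by rw [h i hi]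
  · simp only [Finset.mem_coe, mem_near] at *
    subst he
    omega

/-- If a vertex `w` of the ball burnt already after the spread of the round, its fire would go on to
reach `v` by time `T`, contrary to the earlier misses. Excluding the spread set settles the stricter
convention `afterSpread`, and hence both. -/
lemma isBallPool_pool₃ (s : Timing) :
    IsBallPool (pool₃ s (SimpleGraph.pathGraph (n + 1))) := by
  refine ⟨fun x y t h => ?_, fun x v T t ht h w hw => ?_⟩
  · cases s <;> simp only [pool₃, unburnt, burning_congr _ h]
  · have key : w ∉ spread (SimpleGraph.pathGraph (n + 1))
        (burning (SimpleGraph.pathGraph (n + 1)) x t) := by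
      rw [Finset.mem_coe, mem_near] at hw
      simp only [spread, Set.mem_union, Set.mem_ofPred_eq, mem_burning_iff,
        SimpleGraph.pathGraph_adj, mem_near] at *
      rintro (⟨i, hi, h'⟩ | ⟨u, ⟨i, hi, h'⟩, hu⟩)
      · exact h i hi (by omega)
      · exact h i hi (by omega)
    cases s
    · exact fun hb => key (Or.inl hb)
    · exact key

end Path

/-! ### The burning number of the path up to an additive constant -/

section BurningNumber

lemma spread_mono {V : Type*} (G : SimpleGraph V) {A B : Set V} (h : A ⊆ B) :
    spread G A ⊆ spread G B := by
  rintro v (hv | ⟨u, hu, huv⟩)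
  · exact Or.inl (h hv)
  · exact Or.inr ⟨u, h hu, huv⟩

/-- Every sequence can be replaced by a legal one that burns at least as much. -/
lemma exists_isLegal_burning_subset {V : Type*} (s : Timing) (G : SimpleGraph V) (y : ℕ → V) :
    ∃ x, IsLegal s G x ∧ ∀ t, burning G y t ⊆ burning G x t := by
  classical
  -- The legal sequence is built along with its burning set: `free B` is the set of legal choices
  -- when `B` burns, `c` replaces `y t` only if it is illegal and a legal choice exists, and `st t`
  -- is the resulting burning set.
  let free : Set V → Set V := fun B => match s with
    | Timing.beforeSpread => Bᶜ
    | Timing.afterSpread => (spread G B)ᶜ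
  let c : Set V → ℕ → V := fun B t =>
    if h : y t ∉ free B ∧ (free B).Nonempty then h.2.some else y t
  let st : ℕ → Set V := fun t => Nat.rec ∅ (fun t B => insert (c B t) (spread G B)) t
  have hst : ∀ t, burning G (fun t => c (st t) t) t = st t := by
    intro t
    induction t with
    | zero => rfl
    | succ t ih =>
      change insert _ (spread G (burning G _ t)) = insert (c (st t) t) (spread G (st t))
      rw [ih]
  have hfree : ∀ t, unburnt s G (fun t => c (st t) t) t = free (st t) := by
    intro t
    cases s <;> simp only [unburnt, hst, free]
  have hc : ∀ B t, (free B).Nonempty → c B t ∈ free B := by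
    intro B t h
    by_cases hy : y t ∈ free B
    · simp [c, hy]
    · have : c B t = h.some := dif_pos ⟨hy, h⟩
      rw [this]
      exact h.some_mem
  refine ⟨fun t => c (st t) t, fun t ht => ?_, fun t => ?_⟩
  · rw [hfree] at ht ⊢
    exact hc _ _ ht
  · induction t with
    | zero => exact subset_rfl
    | succ t ih =>
      refine Set.insert_subset ?_ ((spread_mono G ih).trans (Set.subset_insert _ _))
      rw [burning, hst]
      by_cases hy : y t ∈ free (st t)
      · left
        simp [c, hy]
      -- An illegal `y t` is burnt by the spread of this round anyway, so replacing it loses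
      -- nothing.
      · right
        have hle : (free (st t))ᶜ ⊆ spread G (st t) := by
          cases s
          · simp only [free, compl_compl]
            exact Set.subset_union_left
          · simp only [free, compl_compl, subset_rfl]
        exact hle hy

variable {n : ℕ}

lemma burningNumber_spec (s : Timing) (n : ℕ) :
    ∃ x, IsLegal s (SimpleGraph.pathGraph (n + 1)) x ∧
      burning (SimpleGraph.pathGraph (n + 1)) x
        (burningNumber s (SimpleGraph.pathGraph (n + 1))) = Set.univ := by
  obtain ⟨x, hx, -⟩ := exists_isLegal_burning_subset s (SimpleGraph.pathGraph (n + 1)) (fun _ => 0)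
  exact Nat.sInf_mem (s := {k | ∃ x, IsLegal s (SimpleGraph.pathGraph (n + 1)) x ∧
    burning (SimpleGraph.pathGraph (n + 1)) x k = Set.univ})
    ⟨n + 1, x, hx, burning_eq_univ_of_lt x (by omega)⟩

lemma le_sq_burningNumber (s : Timing) (n : ℕ) :
    n + 1 ≤ burningNumber s (SimpleGraph.pathGraph (n + 1)) ^ 2 := by
  obtain ⟨x, -, hx⟩ := burningNumber_spec s n
  exact le_sq_of_burning_eq_univ hx

/-- The path on at most `k ^ 2` vertices is covered by consecutive balls of radii
`k - 1, k - 2, …, 0`. -/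
lemma exists_burning_eq_univ {k : ℕ} (h : n + 1 ≤ k ^ 2) :
    ∃ y, burning (SimpleGraph.pathGraph (n + 1)) y k = Set.univ := by
  -- The balls with indices below `i` tile the first `k² - (k - i)²` positions; the next centre lies
  -- `k - 1 - i` further. The minimum with `n` pulls back centres beyond the end of the path.
  refine ⟨fun i => ⟨min (k ^ 2 - (k - i) ^ 2 + (k - 1 - i)) n, by omega⟩,
    Set.eq_univ_of_forall fun v => (mem_burning_iff _ _ _).2 ?_⟩
  have hv : v.val < k ^ 2 - (k - k) ^ 2 := by
    have := v.isLt
    simp only [tsub_self, ne_eq, OfNat.ofNat_ne_zero, not_false_eq_true, zero_pow, tsub_zero]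
    omega
  have hex : ∃ j, v.val < k ^ 2 - (k - j) ^ 2 := ⟨k, hv⟩
  classical
  -- Least number of balls whose tiles reach past `v`; then `v` lies in tile `j - 1`.
  set j := Nat.find hex with hj
  have h1 : v.val < k ^ 2 - (k - j) ^ 2 := Nat.find_spec hex
  have h2 : j ≤ k := Nat.find_min' hex hv
  have h0 : j ≠ 0 := by
    intro h0
    rw [h0] at h1
    simp at h1
  obtain ⟨i, hi⟩ := Nat.exists_eq_succ_of_ne_zero h0
  have h3 : ¬ v.val < k ^ 2 - (k - i) ^ 2 := Nat.find_min hex (by omega)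
  refine ⟨i, by omega, ?_⟩
  obtain ⟨r, rfl⟩ : ∃ r, k = i + 1 + r := ⟨k - i - 1, by omega⟩
  rw [hi] at h1
  have e1 : i + 1 + r - i.succ = r := by omega
  have e2 : i + 1 + r - i = r + 1 := by omega
  have e3 : i + 1 + r - 1 - i = r := by omega
  have e4 : (r + 1) ^ 2 = r ^ 2 + 2 * r + 1 := by ring
  have e5 : (r + 1) ^ 2 ≤ (i + 1 + r) ^ 2 := Nat.pow_le_pow_left (by omega) 2
  rw [e1] at h1
  rw [e2] at h3
  rw [mem_near]
  simp only [e2, e3]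
  have := v.isLt
  omega

lemma burningNumber_le (s : Timing) {k : ℕ} (h : n + 1 ≤ k ^ 2) :
    burningNumber s (SimpleGraph.pathGraph (n + 1)) ≤ k := by
  obtain ⟨y, hy⟩ := exists_burning_eq_univ h
  obtain ⟨x, hx, hxy⟩ := exists_isLegal_burning_subset s (SimpleGraph.pathGraph (n + 1)) y
  exact Nat.sInf_le ⟨x, hx, Set.eq_univ_of_univ_subset (hy ▸ hxy k)⟩

lemma sqrt_le_of_le_sq {k : ℕ} (h : n + 1 ≤ k ^ 2) : √((n + 1 : ℕ) : ℝ) ≤ k :=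
  Real.sqrt_le_iff.2 ⟨k.cast_nonneg, by exact_mod_cast h⟩

lemma sqrt_le_burningNumber (s : Timing) (n : ℕ) :
    √((n + 1 : ℕ) : ℝ) ≤ (burningNumber s (SimpleGraph.pathGraph (n + 1)) : ℝ) :=
  sqrt_le_of_le_sq (le_sq_burningNumber s n)

lemma burningNumber_le_sqrt_add_one (s : Timing) (n : ℕ) :
    (burningNumber s (SimpleGraph.pathGraph (n + 1)) : ℝ) ≤ √((n + 1 : ℕ) : ℝ) + 1 := by
  have h : n + 1 ≤ ⌈√((n + 1 : ℕ) : ℝ)⌉₊ ^ 2 := by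
    have := Nat.le_ceil (√((n + 1 : ℕ) : ℝ))
    have h2 := (Real.sqrt_le_left (Nat.cast_nonneg _)).1 this
    exact_mod_cast h2
  exact (Nat.cast_le.2 (burningNumber_le s h)).trans (Nat.ceil_lt_add_one (Real.sqrt_nonneg _)).le

end BurningNumber

/-! ### Survival probabilities of sets of vertices -/

section Survival

variable {n : ℕ}

lemma mem_avoid_iff (x : ℕ → Fin (n + 1)) (S : Finset (Fin (n + 1))) (T : ℕ) :
    x ∈ avoid (fun i => (S.biUnion (near (T - 1 - i)) : Set (Fin (n + 1)))) 0 T ↔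
      ∀ v ∈ S, v ∉ burning (SimpleGraph.pathGraph (n + 1)) x T := by
  simp only [avoid, Set.mem_ofPred_eq, Finset.mem_coe, Finset.mem_biUnion, mem_burning_iff]
  constructor
  · rintro h v hv ⟨i, hi, hx⟩
    exact h i (Nat.zero_le _) hi ⟨v, hv, hx⟩
  · rintro h i - hi ⟨v, hv, hx⟩
    exact h v hv ⟨i, hi, hx⟩

lemma IsBallPool.biUnion_subset {pool : (ℕ → Fin (n + 1)) → ℕ → Set (Fin (n + 1))}
    (hp : IsBallPool pool) {S : Finset (Fin (n + 1))} {T t : ℕ} (ht : t < T) {x : ℕ → Fin (n + 1)}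
    (hx : x ∈ avoid (fun i => (S.biUnion (near (T - 1 - i)) : Set (Fin (n + 1)))) 0 t) :
    (S.biUnion (near (T - 1 - t)) : Set (Fin (n + 1))) ⊆ pool x t := by
  intro w hw
  obtain ⟨v, hv, hw⟩ := Finset.mem_biUnion.1 (Finset.mem_coe.1 hw)
  exact hp.subset x v T t ht
    (fun i hi h => hx i (Nat.zero_le _) hi (Finset.mem_coe.2 (Finset.mem_biUnion.2 ⟨v, hv, h⟩))) hw

/-- Survival of all of `S` means that every selection misses a union of balls. Only rounds from `s`
on are charged; the earlier misses serve to put these unions inside the pool. The freedom in `E` and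
`U` lets the third process condition on the past and exploit a small pool. -/
lemma processLaw_real_unburnt_le {pool : (ℕ → Fin (n + 1)) → ℕ → Set (Fin (n + 1))}
    (hp : IsBallPool pool) {S : Finset (Fin (n + 1))} (hS : S.Nonempty) {s T : ℕ} (hsT : s ≤ T)
    {E : Set (ℕ → Fin (n + 1))} (hE : DeterminedBefore E s) {U : ℝ}
    (hU : ∀ t, s ≤ t → t < T → ∀ x ∈ E, ((pool x t).ncard : ℝ) ≤ U) {b : ℕ → ℝ}
    (hb : ∀ k < T - s, b k ≤ (S.biUnion (near k)).card) :
    (processLaw pool).real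
        (E ∩ {x | ∀ v ∈ S, v ∉ burning (SimpleGraph.pathGraph (n + 1)) x T}) ≤
      Real.exp (-(∑ k ∈ Finset.range (T - s), b k) / U) * (processLaw pool).real E := by
  set B : ℕ → Set (Fin (n + 1)) := fun i => (S.biUnion (near (T - 1 - i)) : Set (Fin (n + 1)))
    with hB
  have h1 : E ∩ {x | ∀ v ∈ S, v ∉ burning (SimpleGraph.pathGraph (n + 1)) x T} ⊆
      (E ∩ avoid B 0 s) ∩ avoid B s T := by
    rintro x ⟨hxE, hx⟩
    have hx := (mem_avoid_iff x S T).2 hx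
    exact ⟨⟨hxE, fun i h1 h2 => hx i h1 (by omega)⟩, fun i h1 h2 => hx i (by omega) h2⟩
  have hsum : ∑ i ∈ Finset.Ico s T, b (T - 1 - i) / U =
      (∑ k ∈ Finset.range (T - s), b k) / U := by
    rw [← Finset.sum_div, Finset.sum_Ico_eq_sum_range, ← Finset.sum_range_reflect b]
    congr 1
    refine Finset.sum_congr rfl fun i hi => ?_
    congr 1
    omega
  refine (measureReal_mono h1).trans ((processLaw_real_inter_avoid_le hp.isLocal
    (hE.inter (determinedBefore_avoid B 0 s)) hsT (q := fun i => b (T - 1 - i) / U) ?_).trans ?_)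
  · rintro t hst htT x ⟨⟨hxE, hx0⟩, hx1⟩
    have hx : x ∈ avoid B 0 t := by
      intro i _ hi
      rcases lt_or_ge i s with h | h
      · exact hx0 i (Nat.zero_le _) h
      · exact hx1 i h hi
    have hsub := hp.biUnion_subset htT hx
    have hne : (B t).Nonempty := by
      obtain ⟨v, hv⟩ := hS
      exact ⟨v, Finset.mem_coe.2 (Finset.mem_biUnion.2 ⟨v, hv, self_mem_near _ v⟩)⟩
    rw [stepLaw_real_of_subset hsub hne]
    have hpos : (0 : ℝ) < (pool x t).ncard := by
      exact_mod_cast (Set.ncard_pos (Set.toFinite _)).2 (hne.mono hsub)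
    have hbt : b (T - 1 - t) ≤ ((B t).ncard : ℝ) := by
      rw [hB, Set.ncard_coe_finset]
      exact hb _ (by omega)
    have hUx := hU t hst htT x hxE
    calc b (T - 1 - t) / U ≤ (B t).ncard / U :=
          div_le_div_of_nonneg_right hbt (hpos.le.trans hUx)
      _ ≤ _ := div_le_div_of_nonneg_left (Nat.cast_nonneg _) hpos hUx
  · rw [hsum, neg_div]
    exact mul_le_mul_of_nonneg_left (measureReal_mono Set.inter_subset_left) (Real.exp_nonneg _)

lemma sum_range_two_mul_add_one (T : ℕ) :
    ∑ k ∈ Finset.range T, (2 * (k : ℝ) + 1) = (T : ℝ) ^ 2 := by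
  induction T with
  | zero => simp
  | succ T ih => rw [Finset.sum_range_succ, ih]; push_cast; ring

lemma sq_div_two_le_sum_range (T : ℕ) :
    (T : ℝ) ^ 2 / 2 ≤ ∑ k ∈ Finset.range T, ((k : ℝ) + 1) := by
  induction T with
  | zero => simp
  | succ T ih => rw [Finset.sum_range_succ]; push_cast; linarith

lemma ncard_le_card (A : Set (Fin (n + 1))) : (A.ncard : ℝ) ≤ ((n + 1 : ℕ) : ℝ) := by
  have := Set.ncard_le_card A
  rw [Nat.card_eq_fintype_card, Fintype.card_fin] at this
  exact_mod_cast this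

lemma processLaw_real_notMem_le_exp {pool : (ℕ → Fin (n + 1)) → ℕ → Set (Fin (n + 1))}
    (hp : IsBallPool pool) {S : Finset (Fin (n + 1))} (hS : S.Nonempty) {T : ℕ} {b : ℕ → ℝ}
    (hb : ∀ k < T, b k ≤ (S.biUnion (near k)).card) :
    (processLaw pool).real {x | ∀ v ∈ S, v ∉ burning (SimpleGraph.pathGraph (n + 1)) x T} ≤
      Real.exp (-(∑ k ∈ Finset.range T, b k) / ((n + 1 : ℕ) : ℝ)) := by
  have := processLaw_real_unburnt_le hp hS (Nat.zero_le T) (determinedBefore_univ 0)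
    (U := ((n + 1 : ℕ) : ℝ)) (fun t _ _ x _ => ncard_le_card _) (b := b) (by simpa using hb)
  simpa using this

/-- An interior vertex is unburnt after `T` rounds with probability at most `exp (-T² / N)`. -/
lemma processLaw_real_notMem_le_of_interior
    {pool : (ℕ → Fin (n + 1)) → ℕ → Set (Fin (n + 1))}
    (hp : IsBallPool pool) {v : Fin (n + 1)} {T : ℕ} (h1 : T ≤ v) (h2 : v + T ≤ n) :
    (processLaw pool).real {x | v ∉ burning (SimpleGraph.pathGraph (n + 1)) x T} ≤
      Real.exp (-(T : ℝ) ^ 2 / ((n + 1 : ℕ) : ℝ)) := by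
  have := processLaw_real_notMem_le_exp hp (Finset.singleton_nonempty v) (T := T)
    (b := fun k => 2 * k + 1) fun k hk => by
      rw [Finset.singleton_biUnion, card_near_interior (by omega) (by omega)]
      push_cast
      exact le_rfl
  simpa [sum_range_two_mul_add_one] using this

/-- Every vertex is unburnt after `T` rounds with probability at most `exp (-T² / (2 N))`. -/
lemma processLaw_real_notMem_le {pool : (ℕ → Fin (n + 1)) → ℕ → Set (Fin (n + 1))}
    (hp : IsBallPool pool) (v : Fin (n + 1)) {T : ℕ} (hT : T ≤ n + 1) :
    (processLaw pool).real {x | v ∉ burning (SimpleGraph.pathGraph (n + 1)) x T} ≤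
      Real.exp (-((T : ℝ) ^ 2 / 2) / ((n + 1 : ℕ) : ℝ)) := by
  have := processLaw_real_notMem_le_exp hp (Finset.singleton_nonempty v) (T := T)
    (b := fun k => k + 1) fun k hk => by
      rw [Finset.singleton_biUnion]
      exact_mod_cast succ_le_card_near (by omega) v
  simp only [Finset.mem_singleton, forall_eq] at this
  refine this.trans (Real.exp_le_exp.2 ?_)
  have := sq_div_two_le_sum_range T
  gcongr

lemma disjoint_near {k : ℕ} {v w : Fin (n + 1)} (h : v.val + 2 * k < w.val) :
    Disjoint (near k v) (near k w) := by
  rw [Finset.disjoint_left]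
  intro u hu hu'
  rw [mem_near] at hu hu'
  omega

/-- Two interior vertices at distance at least `2 T` are both unburnt after `T` rounds with
probability at most `exp (-2 T² / N)`. -/
lemma processLaw_real_notMem_pair_le {pool : (ℕ → Fin (n + 1)) → ℕ → Set (Fin (n + 1))}
    (hp : IsBallPool pool) {v w : Fin (n + 1)} {T : ℕ} (h1 : T ≤ v) (h2 : w + T ≤ n)
    (hvw : v.val + 2 * T ≤ w.val) :
    (processLaw pool).real {x | v ∉ burning (SimpleGraph.pathGraph (n + 1)) x T ∧
        w ∉ burning (SimpleGraph.pathGraph (n + 1)) x T} ≤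
      Real.exp (-(2 * (T : ℝ) ^ 2) / ((n + 1 : ℕ) : ℝ)) := by
  have := processLaw_real_notMem_le_exp hp (Finset.insert_nonempty v {w}) (T := T)
    (b := fun k => 2 * (2 * k + 1)) fun k hk => by
      rw [Finset.biUnion_insert, Finset.singleton_biUnion, Finset.card_union_of_disjoint
        (disjoint_near (by omega)), card_near_interior (by omega) (by omega),
        card_near_interior (by omega) (by omega)]
      push_cast
      linarith
  simpa [sum_range_two_mul_add_one, ← Finset.mul_sum] using this

/-- If the pool contains at least `N - t` vertices at time `t`, then every vertex is unburnt after
`T` rounds with probability at least `exp (-T² / (N - 3 T))`. -/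
lemma le_processLaw_real_notMem {pool : (ℕ → Fin (n + 1)) → ℕ → Set (Fin (n + 1))}
    (hp : IsBallPool pool) (hcard : ∀ x t, n + 1 ≤ (pool x t).ncard + t)
    (v : Fin (n + 1)) {T : ℕ} (hT : 3 * T < n + 1) :
    Real.exp (-((T : ℝ) ^ 2 / (((n + 1 : ℕ) : ℝ) - 3 * T))) ≤
      (processLaw pool).real {x | v ∉ burning (SimpleGraph.pathGraph (n + 1)) x T} := by
  set N : ℝ := ((n + 1 : ℕ) : ℝ) with hN
  have hTN : 3 * (T : ℝ) < N := by rw [hN]; exact_mod_cast hT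
  have hT0 : (0 : ℝ) ≤ T := Nat.cast_nonneg T
  set a : ℕ → ℝ := fun t => 2 * ((T - 1 - t : ℕ) : ℝ) + 1 with ha
  have ha2 : ∀ t < T, a t ≤ 2 * T := by
    intro t ht
    have : ((T - 1 - t : ℕ) : ℝ) + 1 ≤ T := by exact_mod_cast (by omega : T - 1 - t + 1 ≤ T)
    simp only [ha]
    linarith
  have ha0 : ∀ t, 0 ≤ a t := fun t => by positivity
  have hset : {x | v ∉ burning (SimpleGraph.pathGraph (n + 1)) x T} =
      avoid (fun i => (({v} : Finset (Fin (n + 1))).biUnion (near (T - 1 - i)) :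
        Set (Fin (n + 1)))) 0 T := by
    ext x
    rw [mem_avoid_iff]
    simp
  rw [hset]
  refine le_trans ?_ (le_processLaw_real_avoid hp.isLocal (q := fun t => a t / (N - T)) ?_ ?_)
  · have hsum : (T : ℝ) ^ 2 = ∑ t ∈ Finset.range T, a t := by
      rw [← sum_range_two_mul_add_one, ← Finset.sum_range_reflect]
    rw [hsum, Finset.sum_div, ← Finset.sum_neg_distrib, Real.exp_sum]
    refine Finset.prod_le_prod (fun _ _ => (Real.exp_nonneg _)) fun t ht => ?_
    have h2 := ha2 t (Finset.mem_range.1 ht)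
    have h0 := ha0 t
    have hpos : 0 < 1 - a t / (N - T) := by
      rw [sub_pos, div_lt_one (by linarith)]
      linarith
    rw [← Real.le_log_iff_exp_le hpos]
    -- With `y = a t / (N - T)`, the bound `log (1 - y) ≥ 1 - 1 / (1 - y)` gives `-a t / (N - T - a
    -- t)`; since `a t ≤ 2 T`, the denominator is at least `N - 3 T`.
    refine le_trans ?_ (Real.one_sub_inv_le_log_of_pos hpos)
    have h3 : (1 - a t / (N - T))⁻¹ = (N - T) / (N - T - a t) := by
      have hne : N - T ≠ 0 := by linarith
      rw [one_sub_div hne, inv_div]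
    have hne' : N - T - a t ≠ 0 := by linarith
    have h4 : 1 - (N - T) / (N - T - a t) = -(a t / (N - T - a t)) := by
      field_simp
      ring
    rw [h3, h4, neg_le_neg_iff]
    exact div_le_div_of_nonneg_left h0 (by linarith) (by linarith)
  · intro t ht x hx
    have hsub := hp.biUnion_subset ht hx
    rw [stepLaw_real_of_subset hsub
      ⟨v, Finset.mem_coe.2 (Finset.mem_biUnion.2 ⟨v, by simp, self_mem_near _ v⟩)⟩]
    have h1 : N ≤ (pool x t).ncard + t := by rw [hN]; exact_mod_cast hcard x t
    have h2 : (t : ℝ) ≤ T := by exact_mod_cast ht.le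
    refine div_le_div₀ (ha0 t) ?_ (by linarith) (by linarith)
    rw [Finset.singleton_biUnion, Set.ncard_coe_finset]
    simp only [ha]
    exact_mod_cast card_near_le _ v
  · intro t ht
    have h2 := ha2 t ht
    rw [div_le_one (by linarith)]
    linarith

lemma le_ncard_pool₁ (x : ℕ → Fin (n + 1)) (t : ℕ) : n + 1 ≤ (pool₁ x t).ncard + t := by
  simp [pool₁, Set.ncard_univ]

lemma le_ncard_pool₂ (x : ℕ → Fin (n + 1)) (t : ℕ) : n + 1 ≤ (pool₂ x t).ncard + t := by
  have h : (Finset.univ : Finset (Fin (n + 1))) ⊆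
      (Set.toFinite (pool₂ x t)).toFinset ∪ (Finset.range t).image x := by
    intro v _
    by_cases hv : v ∈ pool₂ x t
    · simp [hv]
    · simp only [pool₂, Set.mem_ofPred_eq, not_forall, not_not] at hv
      obtain ⟨i, hi, rfl⟩ := hv
      exact Finset.mem_union_right _ (Finset.mem_image_of_mem x (Finset.mem_range.2 hi))
  have h2 := (Finset.card_le_card h).trans (Finset.card_union_le _ _)
  rw [Finset.card_univ, Fintype.card_fin, ← Set.ncard_eq_toFinset_card] at h2
  have h3 := Finset.card_image_le (s := Finset.range t) (f := x)
  rw [Finset.card_range] at h3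
  omega

end Survival

/-! ### Second moment method -/

section SecondMoment

/-- A second moment bound for the probability that none of the events `A i` occurs. -/
lemma measureReal_iInter_compl_le {α ι : Type*} [MeasurableSpace α] {μ : Measure α}
    [IsProbabilityMeasure μ] [Fintype ι] [DecidableEq ι] {A : ι → Set α}
    (hA : ∀ i, MeasurableSet (A i)) {p₁ p₂ : ℝ} (hp₁ : 0 < p₁) (hp₂ : 0 ≤ p₂)
    (h₁ : ∀ i, p₁ ≤ μ.real (A i)) (h₂ : ∀ i j, i ≠ j → μ.real (A i ∩ A j) ≤ p₂)
    (hm : 1 ≤ 2 * (Fintype.card ι * p₁)) :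
    μ.real (⋂ i, (A i)ᶜ) ≤ 1 / (Fintype.card ι * p₁) + (p₂ / p₁ ^ 2 - 1) := by
  set m : ℝ := (Fintype.card ι : ℝ) with hmdef
  set l : ℝ := m * p₁ with hl
  have hl0 : 0 < l := by linarith
  have hm0 : 0 < m := pos_of_mul_pos_left hl0 hp₁.le
  have hC : MeasurableSet (⋂ i, (A i)ᶜ) := MeasurableSet.iInter fun i => (hA i).compl
  set f : ι → α → ℝ := fun i => (A i).indicator 1 with hf
  have hfi : ∀ i, Integrable (f i) μ := fun i => (integrable_const (1 : ℝ)).indicator (hA i)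
  have hff : ∀ i j, (fun x => f i x * f j x) = (A i ∩ A j).indicator 1 := by
    intro i j
    ext x
    by_cases h1 : x ∈ A i <;> by_cases h2 : x ∈ A j <;> simp [hf, h1, h2]
  have hffi : ∀ i j, Integrable (fun x => f i x * f j x) μ := fun i j => by
    rw [hff]
    exact (integrable_const (1 : ℝ)).indicator ((hA i).inter (hA j))
  have hsq : ∀ x, (∑ i, f i x - l) ^ 2 =
      ∑ i, ∑ j, f i x * f j x - 2 * l * ∑ i, f i x + l ^ 2 := by
    intro x
    rw [sub_sq, sq (∑ i, f i x), Finset.sum_mul_sum]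
    ring
  have hi1 : Integrable (fun x => ∑ i, ∑ j, f i x * f j x) μ :=
    integrable_finsetSum _ fun i _ => integrable_finsetSum _ fun j _ => hffi i j
  have hi2 : Integrable (fun x => 2 * l * ∑ i, f i x) μ :=
    (integrable_finsetSum _ fun i _ => hfi i).const_mul _
  have hint : ∫ x, (∑ i, f i x - l) ^ 2 ∂μ =
      ∑ i, ∑ j, μ.real (A i ∩ A j) - 2 * l * ∑ i, μ.real (A i) + l ^ 2 := by
    simp only [hsq]
    rw [integral_add (by exact hi1.sub hi2) (integrable_const _), integral_sub hi1 hi2,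
      integral_const_mul, integral_finsetSum _ (fun i _ => hfi i),
      integral_finsetSum _ (fun i _ => integrable_finsetSum _ fun j _ => hffi i j)]
    have e1 : ∀ i, ∫ x, f i x ∂μ = μ.real (A i) := fun i => integral_indicator_one (hA i)
    have e2 : ∀ i, ∫ x, ∑ j, f i x * f j x ∂μ = ∑ j, μ.real (A i ∩ A j) := by
      intro i
      rw [integral_finsetSum _ fun j _ => hffi i j]
      refine Finset.sum_congr rfl fun j _ => ?_
      rw [hff, integral_indicator_one ((hA i).inter (hA j))]
    simp [e1, e2]
  have hi3 : Integrable (fun x => (∑ i, f i x - l) ^ 2) μ := by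
    simp only [hsq]
    exact (hi1.sub hi2).add (integrable_const _)
  -- The square is taken around `l = m p₁`, a lower bound for the mean, so that exact probabilities
  -- are not needed; where no event occurs it equals `l²`.
  have hle : l ^ 2 * μ.real (⋂ i, (A i)ᶜ) ≤ ∫ x, (∑ i, f i x - l) ^ 2 ∂μ := by
    rw [← integral_indicator_one hC, ← integral_const_mul]
    refine integral_mono (((integrable_const (1 : ℝ)).indicator hC).const_mul _) hi3 fun x => ?_
    by_cases hx : x ∈ ⋂ i, (A i)ᶜ
    · have h0 : ∀ i, f i x = 0 := fun i => Set.indicator_of_notMem (Set.mem_iInter.1 hx i) _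
      simp [hx, h0]
    · simp only [Set.indicator_of_notMem hx, mul_zero]
      positivity
  have hdouble : ∑ i, ∑ j, μ.real (A i ∩ A j) ≤ ∑ i, μ.real (A i) + m ^ 2 * p₂ := by
    have : ∀ i, ∑ j, μ.real (A i ∩ A j) ≤ μ.real (A i) + m * p₂ := by
      intro i
      rw [← Finset.add_sum_erase _ _ (Finset.mem_univ i), Set.inter_self]
      gcongr
      refine (Finset.sum_le_card_nsmul _ _ p₂ fun j hj =>
        h₂ i j (Finset.ne_of_mem_erase hj).symm).trans ?_
      rw [nsmul_eq_mul]
      gcongr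
      rw [hmdef]
      exact_mod_cast Finset.card_erase_le (s := Finset.univ) (a := i)
    refine (Finset.sum_le_sum fun i _ => this i).trans (le_of_eq ?_)
    rw [Finset.sum_add_distrib, Finset.sum_const, Finset.card_univ, nsmul_eq_mul, ← hmdef]
    ring
  have hsum : l ≤ ∑ i, μ.real (A i) := by
    have := Finset.card_nsmul_le_sum Finset.univ (fun i => μ.real (A i)) p₁ fun i _ => h₁ i
    rwa [Finset.card_univ, nsmul_eq_mul] at this
  -- The mean `S` enters through `(1 - 2 l) S`. By `hm` this coefficient is nonpositive, so `S` may
  -- be replaced by its lower bound `l`.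
  have hfin : l ^ 2 * μ.real (⋂ i, (A i)ᶜ) ≤ l + m ^ 2 * p₂ - l ^ 2 := by
    rw [hint] at hle
    nlinarith
  have : 1 / l + (p₂ / p₁ ^ 2 - 1) = (l + m ^ 2 * p₂ - l ^ 2) / l ^ 2 := by
    rw [hl]
    field_simp
    ring
  rw [this, le_div_iff₀ (by positivity), mul_comm]
  exact hfin

end SecondMoment

/-! ### Finite bounds for the probability that the path is, or is not, burnt -/

section Uniform

variable {n : ℕ}

lemma determinedBefore_unburnt (v : Fin (n + 1)) (t : ℕ) :
    DeterminedBefore {x | v ∉ burning (SimpleGraph.pathGraph (n + 1)) x t} t := by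
  intro x y h hx
  rwa [Set.mem_ofPred_eq, ← burning_congr _ h]

/-- All vertices burn after `T + L` rounds, unless some vertex of an `L`-net does not burn after
`T` rounds. -/
lemma processLaw_real_burning_ne_univ_le {pool : (ℕ → Fin (n + 1)) → ℕ → Set (Fin (n + 1))}
    (hp : IsBallPool pool) {T L J : ℕ} (hT : T ≤ n + 1) (hL : 0 < L) (hJ : T ≤ J * L) :
    (processLaw pool).real {x | burning (SimpleGraph.pathGraph (n + 1)) x (T + L) ≠ Set.univ} ≤
      2 * (J + 1) * Real.exp (-((T : ℝ) ^ 2 / 2) / ((n + 1 : ℕ) : ℝ)) +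
        (((n + 1 : ℕ) : ℝ) / L + 1) * Real.exp (-(T : ℝ) ^ 2 / ((n + 1 : ℕ) : ℝ)) := by
  set μ := processLaw pool
  let bad : Fin (n + 1) → Set (ℕ → Fin (n + 1)) :=
    fun v => {x | v ∉ burning (SimpleGraph.pathGraph (n + 1)) x T}
  -- The net has `J + 1` points at each end, where only the weaker survival bound holds, and
  -- interior points at distance at least `T` from both ends.
  let low : ℕ → Fin (n + 1) := fun j => ⟨min (j * L) n, by omega⟩
  let high : ℕ → Fin (n + 1) := fun j => ⟨n - j * L, by omega⟩
  let mid : ℕ → Fin (n + 1) := fun j => ⟨min (T + j * L) n, by omega⟩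
  let I : Finset ℕ := (Finset.range (n / L + 1)).filter fun j => T + j * L + T ≤ n
  have hsub : {x | burning (SimpleGraph.pathGraph (n + 1)) x (T + L) ≠ Set.univ} ⊆
      ((⋃ j ∈ Finset.range (J + 1), bad (low j)) ∪ (⋃ j ∈ Finset.range (J + 1), bad (high j))) ∪
        ⋃ j ∈ I, bad (mid j) := by
    intro x hx
    obtain ⟨v, hv⟩ := (Set.ne_univ_iff_exists_notMem _).1 hx
    have hbad : ∀ w ∈ near L v, x ∈ bad w := fun w hw => not_mem_burning_of_mem_near hv hw
    simp only [Set.mem_union, Set.mem_iUnion, exists_prop, Finset.mem_range]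
    have hvn := v.isLt
    by_cases h1 : v.val < T
    · left; left
      have hd := Nat.div_add_mod' v.val L
      have hm := Nat.mod_lt v.val hL
      refine ⟨v.val / L, ?_, hbad _ ?_⟩
      · have := Nat.div_le_of_le_mul (h1.le.trans (hJ.trans_eq (mul_comm J L)))
        omega
      · simp only [mem_near, low]
        omega
    · by_cases h2 : n < v.val + T
      · left; right
        have hd := Nat.div_add_mod' (n - v.val) L
        have hm := Nat.mod_lt (n - v.val) hL
        refine ⟨(n - v.val) / L, ?_, hbad _ ?_⟩
        · have h3 : n - v.val ≤ L * J := le_trans (by omega) (hJ.trans_eq (mul_comm J L))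
          have := Nat.div_le_of_le_mul h3
          omega
        · simp only [mem_near, high]
          omega
      · right
        have hd := Nat.div_add_mod' (v.val - T) L
        have hm := Nat.mod_lt (v.val - T) hL
        refine ⟨(v.val - T) / L, ?_, hbad _ ?_⟩
        · simp only [I, Finset.mem_filter, Finset.mem_range]
          refine ⟨Nat.lt_succ_of_le (Nat.div_le_div_right (by omega)), by omega⟩
        · simp only [mem_near, mid]
          omega
  have hlow : ∀ (w : ℕ → Fin (n + 1)), μ.real (⋃ j ∈ Finset.range (J + 1), bad (w j)) ≤
      (J + 1) * Real.exp (-((T : ℝ) ^ 2 / 2) / ((n + 1 : ℕ) : ℝ)) := by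
    intro w
    refine (measureReal_biUnion_finset_le _ _).trans ((Finset.sum_le_card_nsmul _ _ _
      fun j _ => processLaw_real_notMem_le hp (w j) hT).trans (le_of_eq ?_))
    rw [Finset.card_range, nsmul_eq_mul]
    push_cast
    ring
  have hmid : μ.real (⋃ j ∈ I, bad (mid j)) ≤
      (((n + 1 : ℕ) : ℝ) / L + 1) * Real.exp (-(T : ℝ) ^ 2 / ((n + 1 : ℕ) : ℝ)) := by
    refine (measureReal_biUnion_finset_le _ _).trans ((Finset.sum_le_card_nsmul _ _
      (Real.exp (-(T : ℝ) ^ 2 / ((n + 1 : ℕ) : ℝ))) fun j hj => ?_).trans ?_)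
    · simp only [I, Finset.mem_filter, Finset.mem_range] at hj
      refine processLaw_real_notMem_le_of_interior hp ?_ ?_ <;> simp only [mid] <;> omega
    · rw [nsmul_eq_mul]
      gcongr
      have h1 : I.card ≤ n / L + 1 := (Finset.card_filter_le _ _).trans_eq (Finset.card_range _)
      have h2 : ((n / L : ℕ) : ℝ) ≤ ((n + 1 : ℕ) : ℝ) / L :=
        Nat.cast_div_le.trans (by gcongr; omega)
      have h3 : (I.card : ℝ) ≤ ((n / L : ℕ) : ℝ) + 1 := by exact_mod_cast h1
      linarith
  refine (measureReal_mono hsub).trans ((measureReal_union_le _ _).trans ?_)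
  have := measureReal_union_le (μ := μ) (⋃ j ∈ Finset.range (J + 1), bad (low j))
    (⋃ j ∈ Finset.range (J + 1), bad (high j))
  have h1 := hlow low
  have h2 := hlow high
  linarith

/-- A second moment bound for the probability that all vertices burn after `T` rounds. -/
lemma processLaw_real_burning_eq_univ_le {pool : (ℕ → Fin (n + 1)) → ℕ → Set (Fin (n + 1))}
    (hp : IsBallPool pool) (hcard : ∀ x t, n + 1 ≤ (pool x t).ncard + t) {T m : ℕ}
    (hT : 3 * T < n + 1) (hmT : m * (2 * T + 1) ≤ n + 1) {p₁ : ℝ} (hp₁ : 0 < p₁)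
    (h₁ : p₁ ≤ Real.exp (-((T : ℝ) ^ 2 / (((n + 1 : ℕ) : ℝ) - 3 * T)))) (hm : 1 ≤ 2 * (m * p₁)) :
    (processLaw pool).real {x | burning (SimpleGraph.pathGraph (n + 1)) x T = Set.univ} ≤
      1 / (m * p₁) + (Real.exp (-(2 * (T : ℝ) ^ 2) / ((n + 1 : ℕ) : ℝ)) / p₁ ^ 2 - 1) := by
  have hlt : ∀ j : Fin m, T + j * (2 * T + 1) + T ≤ n := by
    intro j
    have := Nat.mul_le_mul_right (2 * T + 1) (Nat.succ_le_of_lt j.isLt)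
    rw [Nat.succ_mul] at this
    omega
  -- Spacing `2 T + 1` and margin `T` keep the balls of radius at most `T` disjoint and within the
  -- path.
  let v : Fin m → Fin (n + 1) := fun j => ⟨T + j * (2 * T + 1), by have := hlt j; omega⟩
  have h := measureReal_iInter_compl_le (μ := processLaw pool)
    (A := fun j => {x | v j ∉ burning (SimpleGraph.pathGraph (n + 1)) x T})
    (fun j => (determinedBefore_unburnt _ _).measurableSet) hp₁
    (Real.exp_nonneg (-(2 * (T : ℝ) ^ 2) / ((n + 1 : ℕ) : ℝ)))
    (fun j => h₁.trans (le_processLaw_real_notMem hp hcard (v j) hT)) ?_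
    (by rwa [Fintype.card_fin])
  · rw [Fintype.card_fin] at h
    refine (measureReal_mono ?_).trans h
    intro x hx
    simp only [Set.mem_iInter, Set.mem_compl_iff, Set.mem_ofPred_eq, not_not] at *
    exact fun i => hx ▸ Set.mem_univ _
  · have key : ∀ i j : Fin m, i < j → (processLaw pool).real
        {x | v i ∉ burning (SimpleGraph.pathGraph (n + 1)) x T ∧
          v j ∉ burning (SimpleGraph.pathGraph (n + 1)) x T} ≤
        Real.exp (-(2 * (T : ℝ) ^ 2) / ((n + 1 : ℕ) : ℝ)) := by
      intro i j hij
      refine processLaw_real_notMem_pair_le hp (by simp [v]) (hlt j) ?_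
      have := Nat.mul_le_mul_right (2 * T + 1) (Nat.succ_le_of_lt hij)
      rw [Nat.succ_mul] at this
      simp only [v]
      omega
    intro i j hij
    rcases lt_or_gt_of_ne hij with h | h
    · exact key i j h
    · rw [Set.inter_comm]
      exact key j i h

end Uniform

/-! ### Asymptotics for the first two processes -/

section UniformAsymptotics

/-- The order of magnitude `√(N log N / 2)` on the path with `N = n + 1` vertices. -/
noncomputable def uniformScale (n : ℕ) : ℝ :=
  √(((n + 1 : ℕ) : ℝ) * Real.log ((n + 1 : ℕ) : ℝ) / 2)

lemma tendsto_natCast_succ_atTop : Tendsto (fun n : ℕ => ((n + 1 : ℕ) : ℝ)) atTop atTop :=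
  tendsto_natCast_atTop_atTop.comp (tendsto_add_atTop_nat 1)

lemma tendsto_log_succ_atTop :
    Tendsto (fun n : ℕ => Real.log ((n + 1 : ℕ) : ℝ)) atTop atTop :=
  Real.tendsto_log_atTop.comp tendsto_natCast_succ_atTop

lemma log_succ_nonneg (n : ℕ) : 0 ≤ Real.log ((n + 1 : ℕ) : ℝ) :=
  Real.log_nonneg (by exact_mod_cast Nat.succ_le_succ (Nat.zero_le n))

lemma uniformScale_nonneg (n : ℕ) : 0 ≤ uniformScale n := Real.sqrt_nonneg _

lemma uniformScale_sq (n : ℕ) :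
    uniformScale n ^ 2 = ((n + 1 : ℕ) : ℝ) * Real.log ((n + 1 : ℕ) : ℝ) / 2 :=
  Real.sq_sqrt (div_nonneg (mul_nonneg (Nat.cast_nonneg _) (log_succ_nonneg n)) zero_le_two)

/-- Here `√N` is written as `exp (log N / 2)`, which cancels directly against the survival
probabilities. -/
lemma exp_half_log_sq (n : ℕ) :
    Real.exp (Real.log ((n + 1 : ℕ) : ℝ) / 2) ^ 2 = ((n + 1 : ℕ) : ℝ) := by
  rw [← Real.exp_nat_mul]
  push_cast
  rw [mul_div_cancel₀ _ two_ne_zero, Real.exp_log (by positivity)]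

lemma exp_half_log_le (n : ℕ) (h : 1 ≤ Real.log ((n + 1 : ℕ) : ℝ)) :
    Real.exp (Real.log ((n + 1 : ℕ) : ℝ) / 2) ≤ 2 * uniformScale n := by
  refine pow_le_pow_iff_left₀ (Real.exp_nonneg _) (by linarith [uniformScale_nonneg n])
    two_ne_zero |>.1 ?_
  rw [mul_pow, uniformScale_sq, exp_half_log_sq]
  nlinarith [Nat.cast_nonneg (α := ℝ) (n + 1)]

lemma uniformScale_le (n : ℕ) (h : 1 ≤ Real.log ((n + 1 : ℕ) : ℝ)) :
    uniformScale n ≤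
      Real.exp (Real.log ((n + 1 : ℕ) : ℝ) / 2) * Real.log ((n + 1 : ℕ) : ℝ) := by
  refine pow_le_pow_iff_left₀ (uniformScale_nonneg n) (by positivity) two_ne_zero |>.1 ?_
  rw [mul_pow, uniformScale_sq, exp_half_log_sq]
  nlinarith [mul_nonneg (Nat.cast_nonneg (α := ℝ) (n + 1)) (log_succ_nonneg n),
    Nat.cast_nonneg (α := ℝ) (n + 1)]

lemma tendsto_uniformScale : Tendsto uniformScale atTop atTop := by
  have h : Tendsto (fun n : ℕ => Real.exp (Real.log ((n + 1 : ℕ) : ℝ) / 2) / 2) atTop atTop :=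
    (Real.tendsto_exp_atTop.comp (tendsto_log_succ_atTop.atTop_div_const two_pos)).atTop_div_const
      two_pos
  refine tendsto_atTop_mono' _ ?_ h
  filter_upwards [tendsto_log_succ_atTop.eventually_ge_atTop 1] with n hn
  linarith [exp_half_log_le n hn]

lemma eventually_uniformScale_le : ∀ᶠ n in atTop, 6 * uniformScale n ≤ ((n + 1 : ℕ) : ℝ) := by
  have h := tendsto_natCast_succ_atTop.eventually
    (Real.isLittleO_log_id_atTop.bound (by norm_num : (0 : ℝ) < 1 / 18))
  filter_upwards [h] with n hn
  simp only [id, Real.norm_eq_abs, abs_of_nonneg (log_succ_nonneg n),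
    abs_of_nonneg (Nat.cast_nonneg (α := ℝ) (n + 1))] at hn
  refine pow_le_pow_iff_left₀ (by linarith [uniformScale_nonneg n]) (Nat.cast_nonneg _)
    two_ne_zero |>.1 ?_
  rw [mul_pow, uniformScale_sq]
  nlinarith [Nat.cast_nonneg (α := ℝ) (n + 1)]

/-- This is the error from comparing `T² / (N - 3 T)` with `T² / N`; its square is `(log N)³ / (8
N)`. -/
lemma tendsto_uniformScale_cube_div :
    Tendsto (fun n => uniformScale n ^ 3 / ((n + 1 : ℕ) : ℝ) ^ 2) atTop (𝓝 0) := by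
  have h := (Real.tendsto_pow_log_div_mul_add_atTop 8 0 3 (by norm_num)).comp
    tendsto_natCast_succ_atTop
  have h2 := (Real.continuous_sqrt.tendsto 0).comp h
  rw [Real.sqrt_zero] at h2
  refine h2.congr fun n => ?_
  have hN : (0 : ℝ) < ((n + 1 : ℕ) : ℝ) := by positivity
  simp only [Function.comp]
  refine (Real.sqrt_eq_iff_mul_self_eq (div_nonneg (pow_nonneg (log_succ_nonneg n) 3)
    (by positivity)) (div_nonneg (pow_nonneg (uniformScale_nonneg n) 3) (by positivity))).2 ?_
  have : uniformScale n ^ 3 / ((n + 1 : ℕ) : ℝ) ^ 2 * (uniformScale n ^ 3 / ((n + 1 : ℕ) : ℝ) ^ 2)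
      = (uniformScale n ^ 2) ^ 3 / ((n + 1 : ℕ) : ℝ) ^ 4 := by ring
  rw [this, uniformScale_sq]
  field_simp
  ring

lemma processLaw_real_lt_burningTime_le {n : ℕ}
    {pool : (ℕ → Fin (n + 1)) → ℕ → Set (Fin (n + 1))} (hp : IsBallPool pool) {ε : ℝ}
    (hε : 0 < ε) (hε1 : ε ≤ 1) (hlog : 1 ≤ Real.log ((n + 1 : ℕ) : ℝ))
    (h1 : 2 ≤ ε * uniformScale n) (h2 : 6 * uniformScale n ≤ ((n + 1 : ℕ) : ℝ)) :
    (processLaw pool).real {x | (1 + 3 * ε) * uniformScale n <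
        (burningTime (SimpleGraph.pathGraph (n + 1)) x : ℝ)} ≤
      2 * (⌈(1 + 2 * ε) / ε⌉₊ + 1) * Real.exp (-(Real.log ((n + 1 : ℕ) : ℝ) / 4)) +
        (2 / ε + 1) * Real.exp (-(ε * Real.log ((n + 1 : ℕ) : ℝ))) := by
  set B := uniformScale n
  set l := Real.log ((n + 1 : ℕ) : ℝ)
  have hN : (0 : ℝ) < ((n + 1 : ℕ) : ℝ) := by positivity
  set N := ((n + 1 : ℕ) : ℝ) with hNdef
  have hBsq : B ^ 2 = N * l / 2 := uniformScale_sq n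
  have hB2 : 2 ≤ B := h1.trans (mul_le_of_le_one_left (uniformScale_nonneg n) hε1)
  -- As `ε B ≥ 2` absorbs the roundings, `T + L ≤ (1 + 3 ε) B` and `T ≤ (1 + 2 ε) B ≤ J L`, with `J`
  -- independent of `n`.
  set T := ⌈(1 + ε) * B⌉₊
  set L := ⌈ε * B⌉₊
  set J := ⌈(1 + 2 * ε) / ε⌉₊
  have hT1 : (1 + ε) * B ≤ T := Nat.le_ceil _
  have hT2 : (T : ℝ) < (1 + ε) * B + 1 := Nat.ceil_lt_add_one (by positivity)
  have hL1 : ε * B ≤ L := Nat.le_ceil _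
  have hL2 : (L : ℝ) < ε * B + 1 := Nat.ceil_lt_add_one (by positivity)
  have hJ1 : (1 + 2 * ε) / ε ≤ J := Nat.le_ceil _
  have hTn : T ≤ n + 1 := by
    have : (T : ℝ) ≤ N := by nlinarith
    rw [hNdef] at this
    exact_mod_cast this
  have hL0 : 0 < L := Nat.ceil_pos.2 (by linarith)
  have hTJ : T ≤ J * L := by
    have : (T : ℝ) ≤ J * L := by
      calc (T : ℝ) ≤ (1 + 2 * ε) / ε * (ε * B) := by
            rw [div_mul_eq_mul_div, le_div_iff₀ hε]
            nlinarith
        _ ≤ J * L := mul_le_mul hJ1 hL1 (by linarith) (Nat.cast_nonneg _)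
    exact_mod_cast this
  have hmain := processLaw_real_burning_ne_univ_le hp hTn hL0 hTJ
  refine (measureReal_mono ?_).trans (hmain.trans ?_)
  · intro x hx hburn
    have hx : (1 + 3 * ε) * B < (burningTime (SimpleGraph.pathGraph (n + 1)) x : ℝ) := hx
    have := (burningTime_le_iff x (T + L)).2 hburn
    have : (burningTime (SimpleGraph.pathGraph (n + 1)) x : ℝ) ≤ T + L := by exact_mod_cast this
    nlinarith
  · have hTsq : (1 + 2 * ε) * B ^ 2 ≤ (T : ℝ) ^ 2 := by
      have := pow_le_pow_left₀ (by positivity) hT1 2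
      nlinarith [sq_nonneg (ε * B)]
    have e1 : -((T : ℝ) ^ 2 / 2) / N ≤ -(l / 4) := by
      rw [div_le_iff₀ hN]
      nlinarith [sq_nonneg B]
    -- The term `l / 2` cancels the `√N` in the number of net points; `ε l` is the gain that tends
    -- to infinity.
    have e2 : -(T : ℝ) ^ 2 / N ≤ -(l / 2) + -(ε * l) := by
      rw [div_le_iff₀ hN]
      rw [hBsq] at hTsq
      nlinarith
    have hexp : Real.exp (l / 2) ≤ 2 * B := exp_half_log_le n hlog
    have hexp1 : 1 ≤ Real.exp (l / 2) := Real.one_le_exp (by linarith)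
    have e3 : N / L ≤ 2 / ε * Real.exp (l / 2) := by
      have hB0 : 0 < ε * B := by linarith
      calc N / L ≤ N / (ε * B) := div_le_div_of_nonneg_left hN.le hB0 hL1
        _ ≤ _ := by
          rw [div_le_iff₀ hB0, show N = Real.exp (l / 2) ^ 2 from (exp_half_log_sq n).symm]
          have : 2 / ε * Real.exp (l / 2) * (ε * B) = Real.exp (l / 2) * (2 * B) := by
            field_simp
          rw [this, sq]
          exact mul_le_mul_of_nonneg_left hexp (by positivity)
    have e4 : (N / L + 1) * Real.exp (-(T : ℝ) ^ 2 / N) ≤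
        (2 / ε + 1) * Real.exp (-(ε * l)) := by
      calc (N / L + 1) * Real.exp (-(T : ℝ) ^ 2 / N)
          ≤ ((2 / ε + 1) * Real.exp (l / 2)) * Real.exp (-(l / 2) + -(ε * l)) := by
            refine mul_le_mul (by linarith) (Real.exp_le_exp.2 e2) (Real.exp_nonneg _)
              (by positivity)
        _ = _ := by rw [Real.exp_add, Real.exp_neg (l / 2)]; field_simp
    gcongr

/-- A.a.s. the burning time of a process that selects from a ball pool is at most
`(1 + ε) √(N log N / 2)`. -/
lemma tendsto_processLaw_real_lt_burningTime
    {pool : ∀ n, (ℕ → Fin (n + 1)) → ℕ → Set (Fin (n + 1))} (hp : ∀ n, IsBallPool (pool n))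
    {ε : ℝ} (hε : 0 < ε) :
    Tendsto (fun n => (processLaw (pool n)).real {x | (1 + ε) * uniformScale n <
      (burningTime (SimpleGraph.pathGraph (n + 1)) x : ℝ)}) atTop (𝓝 0) := by
  set δ := min (ε / 3) 1 with hδdef
  have hδ : 0 < δ := lt_min (by linarith) one_pos
  have hδε : 3 * δ ≤ ε := by linarith [min_le_left (ε / 3) 1]
  have hlim : Tendsto (fun n : ℕ =>
      2 * (⌈(1 + 2 * δ) / δ⌉₊ + 1) * Real.exp (-(Real.log ((n + 1 : ℕ) : ℝ) / 4)) +
        (2 / δ + 1) * Real.exp (-(δ * Real.log ((n + 1 : ℕ) : ℝ)))) atTop (𝓝 0) := by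
    have h1 := (Real.tendsto_exp_neg_atTop_nhds_zero.comp
      (tendsto_log_succ_atTop.atTop_div_const four_pos)).const_mul
        (2 * ((⌈(1 + 2 * δ) / δ⌉₊ : ℝ) + 1))
    have h2 := (Real.tendsto_exp_neg_atTop_nhds_zero.comp
      (tendsto_log_succ_atTop.const_mul_atTop hδ)).const_mul (2 / δ + 1)
    simpa using h1.add h2
  refine squeeze_zero' (Eventually.of_forall fun n => measureReal_nonneg) ?_ hlim
  filter_upwards [tendsto_log_succ_atTop.eventually_ge_atTop 1,
    (tendsto_uniformScale.const_mul_atTop hδ).eventually_ge_atTop 2,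
    eventually_uniformScale_le] with n hn1 hn2 hn3
  refine (measureReal_mono fun x hx => ?_).trans
    (processLaw_real_lt_burningTime_le (hp n) hδ (min_le_right _ _) hn1 hn2 hn3)
  simp only [Set.mem_ofPred_eq] at hx ⊢
  nlinarith [uniformScale_nonneg n]

lemma processLaw_real_burningTime_lt_le {n : ℕ}
    {pool : (ℕ → Fin (n + 1)) → ℕ → Set (Fin (n + 1))} (hp : IsBallPool pool)
    (hcard : ∀ x t, n + 1 ≤ (pool x t).ncard + t) {ε : ℝ}
    (hε : 0 < ε) (hε1 : ε ≤ 1) (hlog : 1 ≤ Real.log ((n + 1 : ℕ) : ℝ))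
    (h1 : 1 ≤ uniformScale n) (h2 : 6 * uniformScale n ≤ ((n + 1 : ℕ) : ℝ))
    (h3 : 6 * (uniformScale n ^ 3 / ((n + 1 : ℕ) : ℝ) ^ 2) ≤ 1)
    (h4 : 6 * Real.log ((n + 1 : ℕ) : ℝ) *
      Real.exp (1 - ε / 2 * Real.log ((n + 1 : ℕ) : ℝ)) ≤ 2) :
    (processLaw pool).real {x | (burningTime (SimpleGraph.pathGraph (n + 1)) x : ℝ) <
        (1 - ε) * uniformScale n} ≤
      6 * Real.log ((n + 1 : ℕ) : ℝ) * Real.exp (1 - ε / 2 * Real.log ((n + 1 : ℕ) : ℝ)) +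
        (Real.exp (12 * (uniformScale n ^ 3 / ((n + 1 : ℕ) : ℝ) ^ 2)) - 1) := by
  have hBsq := uniformScale_sq n
  have hBle := uniformScale_le n hlog
  have hexpsq := exp_half_log_sq n
  have hN : (0 : ℝ) < ((n + 1 : ℕ) : ℝ) := by positivity
  have hB0 := uniformScale_nonneg n
  set B := uniformScale n
  set l := Real.log ((n + 1 : ℕ) : ℝ)
  set N := ((n + 1 : ℕ) : ℝ) with hNdef
  set T := ⌊(1 - ε) * B⌋₊
  set m := (n + 1) / (2 * T + 1)
  have hTε : (T : ℝ) ≤ (1 - ε) * B := Nat.floor_le (mul_nonneg (by linarith) hB0)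
  have hTB : (T : ℝ) ≤ B := by nlinarith
  have hT0 : (0 : ℝ) ≤ T := Nat.cast_nonneg T
  have hTN : 3 * (T : ℝ) ≤ N / 2 := by linarith
  have hTn : 3 * T < n + 1 := by
    have : ((3 * T : ℕ) : ℝ) < ((n + 1 : ℕ) : ℝ) := by push_cast; push_cast at hTN hNdef; linarith
    exact_mod_cast this
  have hmT : m * (2 * T + 1) ≤ n + 1 := Nat.div_mul_le_self _ _
  -- `2 T + 1 ≤ 3 B` gives `m + 1 > N / (3 B)`, and half of this is at least `1`, which pays for the
  -- floor.
  have hm : N / (6 * B) ≤ m := by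
    have e1 : N / (2 * T + 1) < m + 1 := by
      rw [div_lt_iff₀ (by positivity), hNdef]
      have := Nat.lt_mul_of_div_lt (Nat.lt_succ_self m) (Nat.succ_pos (2 * T))
      exact_mod_cast this
    have e2 : N / (3 * B) ≤ N / (2 * T + 1) :=
      div_le_div_of_nonneg_left hN.le (by positivity) (by linarith)
    have e3 : 1 ≤ N / (6 * B) := (one_le_div (by positivity)).2 h2
    have e4 : N / (3 * B) = 2 * (N / (6 * B)) := by field_simp; norm_num
    linarith
  have hcube : (T : ℝ) ^ 2 / (N - 3 * T) ≤ T ^ 2 / N + 6 * (B ^ 3 / N ^ 2) := by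
    have e1 : (T : ℝ) ^ 2 / (N - 3 * T) = T ^ 2 / N + 3 * T ^ 3 / (N * (N - 3 * T)) := by
      have hne : N - 3 * T ≠ 0 := by linarith
      rw [div_add_div _ _ hN.ne' (mul_ne_zero hN.ne' hne),
        div_eq_div_iff hne (mul_ne_zero hN.ne' (mul_ne_zero hN.ne' hne))]
      ring
    have e2 : 3 * (T : ℝ) ^ 3 / (N * (N - 3 * T)) ≤ 3 * B ^ 3 / (N * (N / 2)) := by
      refine div_le_div₀ (by positivity) ?_ (by positivity) ?_
      · gcongr
      · gcongr
        linarith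
    rw [e1]
    refine add_le_add_right (e2.trans (le_of_eq ?_)) _
    field_simp
    norm_num
  set p := Real.exp (-((T : ℝ) ^ 2 / (N - 3 * T))) with hp_def
  have hp0 : 0 < p := Real.exp_pos _
  -- The main term is at most `(1 - ε) l / 2`; the `1` bounds the cubic error through `h3`.
  have hp1 : Real.exp (-(l / 2) + (ε / 2 * l - 1)) ≤ p := by
    rw [hp_def, Real.exp_le_exp]
    have : (T : ℝ) ^ 2 / N ≤ (1 - ε) * l / 2 := by
      rw [div_le_iff₀ hN]
      have e1 := pow_le_pow_left₀ hT0 hTε 2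
      have e2 : ((1 - ε) * B) ^ 2 ≤ (1 - ε) * B ^ 2 := by
        nlinarith [sq_nonneg B, mul_nonneg hε.le (mul_nonneg (sub_nonneg.2 hε1) (sq_nonneg B))]
      rw [hBsq] at e2
      nlinarith
    linarith
  -- The expected number of survivors tends to infinity: `N / (6 B)` is at least `√N / (6 l)`, and
  -- this `√N` cancels `exp (-(l / 2))`.
  have hmp : Real.exp (ε / 2 * l - 1) / (6 * l) ≤ m * p := by
    calc Real.exp (ε / 2 * l - 1) / (6 * l)
        = Real.exp (l / 2) / (6 * l) * Real.exp (-(l / 2) + (ε / 2 * l - 1)) := by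
          rw [Real.exp_add, Real.exp_neg (l / 2)]
          field_simp
      _ ≤ N / (6 * B) * p := by
          refine mul_le_mul ?_ hp1 (Real.exp_nonneg _) (by positivity)
          rw [div_le_div_iff₀ (by positivity) (by positivity), ← hexpsq]
          have := mul_le_mul_of_nonneg_left hBle (Real.exp_nonneg (l / 2))
          nlinarith
      _ ≤ m * p := mul_le_mul_of_nonneg_right hm hp0.le
  have hpos : 0 < Real.exp (ε / 2 * l - 1) / (6 * l) := by positivity
  have hinv : 1 / (m * p) ≤ 6 * l * Real.exp (1 - ε / 2 * l) := by
    refine (one_div_le_one_div_of_le hpos hmp).trans (le_of_eq ?_)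
    rw [one_div_div, div_eq_mul_inv, ← Real.exp_neg]
    congr 2
    ring
  have hmp2 : 1 ≤ 2 * (m * p) := by
    have h5 := hinv.trans h4
    rw [div_le_iff₀ (hpos.trans_le hmp)] at h5
    exact h5
  refine (measureReal_mono ?_).trans ((processLaw_real_burning_eq_univ_le hp hcard hTn hmT hp0
    le_rfl hmp2).trans (add_le_add hinv (sub_le_sub_right ?_ 1)))
  · intro x hx
    exact (burningTime_le_iff x T).1 (Nat.le_floor (le_of_lt hx))
  · rw [hp_def, ← Real.exp_nat_mul, ← Real.exp_sub, Real.exp_le_exp]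
    have : -(2 * (T : ℝ) ^ 2) / N = -2 * ((T : ℝ) ^ 2 / N) := by ring
    rw [Nat.cast_ofNat, this]
    linarith

/-- A.a.s. the burning time of a process that selects from a ball pool, from which at most one
vertex is removed in each round, is at least `(1 - ε) √(N log N / 2)`. -/
lemma tendsto_processLaw_real_burningTime_lt
    {pool : ∀ n, (ℕ → Fin (n + 1)) → ℕ → Set (Fin (n + 1))} (hp : ∀ n, IsBallPool (pool n))
    (hcard : ∀ n x t, n + 1 ≤ (pool n x t).ncard + t) {ε : ℝ} (hε : 0 < ε) :
    Tendsto (fun n => (processLaw (pool n)).real {x |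
      (burningTime (SimpleGraph.pathGraph (n + 1)) x : ℝ) < (1 - ε) * uniformScale n})
      atTop (𝓝 0) := by
  set δ := min ε 1 with hδdef
  have hδ : 0 < δ := lt_min hε one_pos
  have hδε : δ ≤ ε := min_le_left ε 1
  have hlim1 : Tendsto (fun n : ℕ => 6 * Real.log ((n + 1 : ℕ) : ℝ) *
      Real.exp (1 - δ / 2 * Real.log ((n + 1 : ℕ) : ℝ))) atTop (𝓝 0) := by
    have h := (Real.tendsto_pow_mul_exp_neg_atTop_nhds_zero 1).comp
      (tendsto_log_succ_atTop.const_mul_atTop (half_pos hδ))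
    have h2 := h.const_mul (6 * Real.exp 1 / (δ / 2))
    rw [mul_zero] at h2
    refine h2.congr fun n => ?_
    simp only [Function.comp, pow_one]
    rw [sub_eq_add_neg, Real.exp_add]
    field_simp
  have hlim2 : Tendsto (fun n : ℕ =>
      Real.exp (12 * (uniformScale n ^ 3 / ((n + 1 : ℕ) : ℝ) ^ 2)) - 1) atTop (𝓝 0) := by
    have := (((Real.continuous_exp.tendsto _).comp
      (tendsto_uniformScale_cube_div.const_mul 12))).sub_const 1
    simpa using this
  have hlim3 := tendsto_uniformScale_cube_div.const_mul 6
  rw [mul_zero] at hlim3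
  have hlim := hlim1.add hlim2
  rw [add_zero] at hlim
  refine squeeze_zero' (Eventually.of_forall fun n => measureReal_nonneg) ?_ hlim
  filter_upwards [tendsto_log_succ_atTop.eventually_ge_atTop 1,
    tendsto_uniformScale.eventually_ge_atTop 1, eventually_uniformScale_le,
    hlim3.eventually_le_const one_pos, hlim1.eventually_le_const two_pos] with n h1 h2 h3 h4 h5
  refine (measureReal_mono fun x hx => ?_).trans
    (processLaw_real_burningTime_lt_le (hp n) (hcard n) hδ (min_le_right _ _) h1 h2 h3 h4 h5)
  simp only [Set.mem_ofPred_eq] at hx ⊢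
  nlinarith [uniformScale_nonneg n]

end UniformAsymptotics

/-! ### The third process: halving the scale in phases -/

section Phases

variable {n : ℕ}

/-- The number of vertices that are not burning at the end of round `t`. -/
noncomputable def unburntCard (x : ℕ → Fin (n + 1)) (t : ℕ) : ℕ :=
  (burning (SimpleGraph.pathGraph (n + 1)) x t)ᶜ.ncard

open Classical in
/-- The multiples of `L` that are not burning at the end of round `t`. -/
noncomputable def unburntGrid (L : ℕ) (x : ℕ → Fin (n + 1)) (t : ℕ) : Finset (Fin (n + 1)) :=
  Finset.univ.filter fun v => L ∣ v.val ∧ v ∉ burning (SimpleGraph.pathGraph (n + 1)) x t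

lemma mem_unburntGrid {L : ℕ} {x : ℕ → Fin (n + 1)} {t : ℕ} {v : Fin (n + 1)} :
    v ∈ unburntGrid L x t ↔
      L ∣ v.val ∧ v ∉ burning (SimpleGraph.pathGraph (n + 1)) x t := by
  simp [unburntGrid]

lemma unburntGrid_congr (L : ℕ) {x y : ℕ → Fin (n + 1)} {t : ℕ} (h : ∀ i < t, x i = y i) :
    unburntGrid L x t = unburntGrid L y t := by
  ext v
  simp only [mem_unburntGrid, burning_congr _ h]

lemma unburntGrid_anti (L : ℕ) (x : ℕ → Fin (n + 1)) {s t : ℕ} (h : s ≤ t) :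
    unburntGrid L x t ⊆ unburntGrid L x s := by
  intro v hv
  rw [mem_unburntGrid] at *
  exact ⟨hv.1, fun hb => hv.2 (burning_mono x h hb)⟩

lemma unburntCard_congr {x y : ℕ → Fin (n + 1)} {t : ℕ} (h : ∀ i < t, x i = y i) :
    unburntCard x t = unburntCard y t := by
  rw [unburntCard, unburntCard, burning_congr _ h]

lemma ncard_unburnt_le (s : Timing) (x : ℕ → Fin (n + 1)) {t₀ t : ℕ} (h : t₀ ≤ t) :
    (unburnt s (SimpleGraph.pathGraph (n + 1)) x t).ncard ≤ unburntCard x t₀ :=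
  Set.ncard_le_ncard ((unburnt_subset s _ x t).trans
    (Set.compl_subset_compl.2 (burning_mono x h))) (Set.toFinite _)

lemma disjoint_near_of_dvd {r k : ℕ} (hk : k ≤ r) {v w : Fin (n + 1)} (hv : 2 * r + 1 ∣ v.val)
    (hw : 2 * r + 1 ∣ w.val) (hvw : v ≠ w) : Disjoint (near k v) (near k w) := by
  have key : ∀ {v w : Fin (n + 1)}, 2 * r + 1 ∣ v.val → 2 * r + 1 ∣ w.val → v < w →
      Disjoint (near k v) (near k w) := by
    intro v w hv hw hvw
    have h := Nat.le_of_dvd (Nat.sub_pos_of_lt (Fin.lt_def.1 hvw)) (Nat.dvd_sub hw hv)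
    exact disjoint_near (by omega)
  rcases lt_or_gt_of_ne hvw with h | h
  · exact key hv hw h
  · exact (key hw hv h).symm

lemma card_mul_le_card_biUnion_near {r k : ℕ} (hk : k ≤ r) (hkn : k ≤ n)
    {S : Finset (Fin (n + 1))} (hS : ∀ v ∈ S, 2 * r + 1 ∣ v.val) :
    S.card * (k + 1) ≤ (S.biUnion (near k)).card := by
  rw [Finset.card_biUnion fun v hv w hw hvw =>
    disjoint_near_of_dvd hk (hS v hv) (hS w hw) hvw, ← smul_eq_mul]
  exact Finset.card_nsmul_le_sum _ _ _ fun v _ => succ_le_card_near hkn v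

/-- Grid vertices that stay unburnt for `r` further rounds account for `r + 1` unburnt vertices
each. -/
lemma card_unburntGrid_mul_le {r : ℕ} (hr : r ≤ n) (x : ℕ → Fin (n + 1)) (t : ℕ) :
    (unburntGrid (2 * r + 1) x (t + r)).card * (r + 1) ≤ unburntCard x t := by
  refine (card_mul_le_card_biUnion_near le_rfl hr fun v hv => (mem_unburntGrid.1 hv).1).trans ?_
  rw [unburntCard, ← Set.ncard_coe_finset]
  refine Set.ncard_le_ncard (fun w hw => ?_) (Set.toFinite _)
  obtain ⟨v, hv, hw⟩ := Finset.mem_biUnion.1 (Finset.mem_coe.1 hw)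
  exact not_mem_burning_of_mem_near (mem_unburntGrid.1 hv).2 hw

/-- After `L` rounds, only vertices right behind unburnt grid vertices can be unburnt. -/
lemma unburntCard_add_le {L : ℕ} (hL : 0 < L) (x : ℕ → Fin (n + 1)) (t : ℕ) :
    unburntCard x (t + L) ≤ (unburntGrid L x t).card * L := by
  have hsub : (burning (SimpleGraph.pathGraph (n + 1)) x (t + L))ᶜ ⊆
      ((unburntGrid L x t).biUnion fun w => Finset.Icc w ⟨min (w + (L - 1)) n, by omega⟩ :
        Finset (Fin (n + 1))) := by
    intro v hv
    have hd := Nat.div_add_mod' v.val L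
    have hm := Nat.mod_lt v.val hL
    have hvn := v.isLt
    refine Finset.mem_coe.2 (Finset.mem_biUnion.2 ⟨⟨v.val / L * L, by omega⟩, ?_, ?_⟩)
    · refine mem_unburntGrid.2 ⟨Dvd.intro_left _ rfl, not_mem_burning_of_mem_near hv ?_⟩
      rw [mem_near]
      simp only
      omega
    · simp only [Finset.mem_Icc, Fin.le_def]
      omega
  refine (Set.ncard_le_ncard hsub (Set.toFinite _)).trans ?_
  rw [Set.ncard_coe_finset]
  refine Finset.card_biUnion_le_card_mul _ _ _ fun w _ => ?_
  rw [Fin.card_Icc]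
  simp only
  omega

/-- From a situation with at most `(2 τ)²` unburnt vertices, the third process needs more than
`80 τ + 1` rounds to reach one with at most `τ²` unburnt vertices only with probability
exponentially small in `τ`. -/
lemma processLaw_real_phase_le (s : Timing) {τ : ℕ} (hτ : 41 ≤ τ) (hτn : 20 * τ ≤ n) (t₀ : ℕ) :
    (processLaw (pool₃ s (SimpleGraph.pathGraph (n + 1)))).real
      {x | unburntCard x t₀ ≤ (2 * τ) ^ 2 ∧ τ ^ 2 < unburntCard x (t₀ + (80 * τ + 1))} ≤
      Real.exp (-((τ : ℝ) / 5)) := by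
  set μ := processLaw (pool₃ s (SimpleGraph.pathGraph (n + 1)))
  -- A phase consists of `r + r + L` rounds. The first `r` force the number of surviving grid
  -- vertices down to `τ / 5`. In the second `r`, a union bound over `m`-subsets of these survivors
  -- shows that fewer than `m` are likely to remain. The last `L` rounds then leave at most `m L ≤
  -- τ²` unburnt vertices; `m = τ / 41` is chosen because `L ≤ 41 τ`.
  set r := 20 * τ with hr
  set L := 2 * r + 1 with hL
  set m := τ / 41
  set t₁ := t₀ + r with ht₁
  set t₂ := t₁ + r with ht₂
  have hm1 : 1 ≤ m := (Nat.le_div_iff_mul_le (by norm_num)).2 (by omega)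
  have hmτ : τ ≤ 82 * m := by omega
  have hmL : m * L ≤ τ ^ 2 := by
    have h1 : L ≤ 41 * τ := by omega
    have h2 : m * 41 ≤ τ := Nat.div_mul_le_self _ _
    calc m * L ≤ m * (41 * τ) := Nat.mul_le_mul_left _ h1
      _ = m * 41 * τ := by ring
      _ ≤ τ * τ := Nat.mul_le_mul_right _ h2
      _ = τ ^ 2 := by ring
  have hτ0 : (0 : ℝ) < τ := by exact_mod_cast (by omega : 0 < τ)
  -- Fixing the surviving grid set `g` at time `t₁` makes the family of subsets in the union bound
  -- deterministic; the events `E g` are disjoint.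
  let E : Finset (Fin (n + 1)) → Set (ℕ → Fin (n + 1)) :=
    fun g => {x | unburntCard x t₀ ≤ (2 * τ) ^ 2 ∧ unburntGrid L x t₁ = g}
  have hEdet : ∀ g, DeterminedBefore (E g) t₁ := by
    intro g x y h hx
    have h1 : unburntCard y t₀ = unburntCard x t₀ :=
      (unburntCard_congr fun i hi => h i (by omega)).symm
    have h2 := (unburntGrid_congr L h).symm
    simp only [E, Set.mem_ofPred_eq] at hx ⊢
    rwa [h1, h2]
  have hsub : {x | unburntCard x t₀ ≤ (2 * τ) ^ 2 ∧ τ ^ 2 < unburntCard x (t₀ + (80 * τ + 1))} ⊆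
      ⋃ g ∈ (Finset.univ : Finset (Finset (Fin (n + 1)))), ⋃ S ∈ g.powersetCard m,
        E g ∩ {x | ∀ v ∈ S, v ∉ burning (SimpleGraph.pathGraph (n + 1)) x t₂} := by
    rintro x ⟨hx1, hx2⟩
    have ht : t₀ + (80 * τ + 1) = t₂ + L := by omega
    rw [ht] at hx2
    have hcard : m ≤ (unburntGrid L x t₂).card := by
      by_contra! h
      have := unburntCard_add_le (by omega : 0 < L) x t₂
      have h3 := Nat.mul_le_mul_right L h.le
      omega
    obtain ⟨S, hS, hSm⟩ := Finset.exists_subset_card_eq hcard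
    simp only [Set.mem_iUnion]
    exact ⟨unburntGrid L x t₁, Finset.mem_univ _, S,
      Finset.mem_powersetCard.2 ⟨hS.trans (unburntGrid_anti L x (by omega)), hSm⟩,
      ⟨hx1, rfl⟩, fun v hv => (mem_unburntGrid.1 (hS hv)).2⟩
  have hbound : ∀ g, μ.real (⋃ S ∈ g.powersetCard m,
      E g ∩ {x | ∀ v ∈ S, v ∉ burning (SimpleGraph.pathGraph (n + 1)) x t₂}) ≤
        Real.exp (-((τ : ℝ) / 5)) * μ.real (E g) := by
    intro g
    rcases Set.eq_empty_or_nonempty (E g) with hE | ⟨y, hy⟩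
    · simp [hE]
    have hgrid : ∀ v ∈ g, L ∣ v.val := fun v hv => by
      rw [← hy.2] at hv
      exact (mem_unburntGrid.1 hv).1
    have hg : (g.card : ℝ) ≤ τ / 5 := by
      have h1 := (card_unburntGrid_mul_le hτn y t₀).trans hy.1
      rw [hy.2] at h1
      have h2 : (g.card : ℝ) * (20 * τ + 1) ≤ (2 * τ) ^ 2 := by exact_mod_cast h1
      nlinarith [Nat.cast_nonneg (α := ℝ) g.card]
    have hS : ∀ S ∈ g.powersetCard m,
        μ.real (E g ∩ {x | ∀ v ∈ S, v ∉ burning (SimpleGraph.pathGraph (n + 1)) x t₂}) ≤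
          Real.exp (-(50 * m)) * μ.real (E g) := by
      intro S hS
      obtain ⟨hSg, hSm⟩ := Finset.mem_powersetCard.1 hS
      have hne : S.Nonempty := Finset.card_pos.1 (by omega)
      have h := processLaw_real_unburnt_le (isBallPool_pool₃ s) hne (by omega : t₁ ≤ t₂)
        (hEdet g) (U := (2 * τ) ^ 2) (fun t ht _ x hx => ?_) (b := fun k => m * (k + 1))
        (fun k hk => ?_)
      · refine h.trans (mul_le_mul_of_nonneg_right (Real.exp_le_exp.2 ?_) measureReal_nonneg)
        have hrt : t₂ - t₁ = r := by omega
        have hsum := sq_div_two_le_sum_range r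
        rw [hrt, ← Finset.mul_sum, div_le_iff₀ (by positivity), neg_mul, neg_le_neg_iff]
        -- The exponent is `m (r² / 2)` over the pool bound `(2 τ)²`; with `r = 20 τ` this is `50
        -- m`.
        have e : 50 * (m : ℝ) * (2 * τ) ^ 2 = m * ((r : ℝ) ^ 2 / 2) := by
          rw [hr]
          push_cast
          ring
        rw [e]
        exact mul_le_mul_of_nonneg_left hsum (Nat.cast_nonneg _)
      · exact_mod_cast (ncard_unburnt_le s x (by omega)).trans hx.1
      · have := card_mul_le_card_biUnion_near (by omega : k ≤ r) (by omega)
          fun v hv => hgrid v (hSg hv)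
        rw [hSm] at this
        exact_mod_cast this
    refine (measureReal_biUnion_finset_le _ _).trans ((Finset.sum_le_card_nsmul _ _ _ hS).trans ?_)
    rw [nsmul_eq_mul, ← mul_assoc]
    refine mul_le_mul_of_nonneg_right ?_ measureReal_nonneg
    have h1 : ((g.powersetCard m).card : ℝ) ≤ 2 ^ g.card := by
      rw [Finset.card_powersetCard]
      exact_mod_cast Nat.choose_le_two_pow _ _
    have h2 : (2 : ℝ) ^ g.card ≤ Real.exp (τ / 5) := by
      calc (2 : ℝ) ^ g.card ≤ Real.exp 1 ^ g.card :=
            pow_le_pow_left₀ zero_le_two (by linarith [Real.add_one_le_exp (1 : ℝ)]) _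
        _ = Real.exp g.card := by rw [← Real.exp_nat_mul, mul_one]
        _ ≤ _ := Real.exp_le_exp.2 hg
    calc ((g.powersetCard m).card : ℝ) * Real.exp (-(50 * m))
        ≤ Real.exp (τ / 5) * Real.exp (-(50 * m)) :=
          mul_le_mul_of_nonneg_right (h1.trans h2) (Real.exp_nonneg _)
      _ ≤ _ := by
        rw [← Real.exp_add, Real.exp_le_exp]
        -- Since `50 m ≥ (50 / 82) τ`, which exceeds `2 τ / 5`, a factor `exp (-(τ / 5))` is left
        -- after paying for the subsets.
        have : (τ : ℝ) ≤ 82 * m := by exact_mod_cast hmτ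
        linarith
  have hdisj : ∑ g, μ.real (E g) ≤ 1 := by
    rw [← measureReal_biUnion_finset (fun g _ g' _ hgg' => ?_)
      (fun g _ => (hEdet g).measurableSet)]
    · exact measureReal_le_one
    · exact Set.disjoint_left.2 fun x hx hx' => hgg' (hx.2.symm.trans hx'.2)
  refine (measureReal_mono hsub (measure_ne_top _ _)).trans ((measureReal_biUnion_finset_le _ _).trans
    ((Finset.sum_le_sum fun g _ => hbound g).trans ?_))
  rw [← Finset.mul_sum]
  exact mul_le_of_le_one_right (Real.exp_nonneg _) hdisj

/-- The scale runs through `β * 2 ^ (K - 1), …, β`; each phase fails with at most the probability of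
the last one, whose scale is smallest. -/
lemma processLaw_real_phases_le (s : Timing) {β : ℕ} (hβ : 41 ≤ β) (K : ℕ)
    (hn : 20 * (β * 2 ^ K) ≤ n) (t₀ : ℕ) :
    (processLaw (pool₃ s (SimpleGraph.pathGraph (n + 1)))).real
      {x | unburntCard x t₀ ≤ (β * 2 ^ K) ^ 2 ∧
        β ^ 2 < unburntCard x (t₀ + ∑ j ∈ Finset.range K, (80 * (β * 2 ^ j) + 1))} ≤
      K * Real.exp (-((β : ℝ) / 5)) := by
  induction K generalizing t₀ with
  | zero =>
    have : {x : ℕ → Fin (n + 1) | unburntCard x t₀ ≤ (β * 2 ^ 0) ^ 2 ∧ β ^ 2 <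
        unburntCard x (t₀ + ∑ j ∈ Finset.range 0, (80 * (β * 2 ^ j) + 1))} = ∅ := by
      ext x
      simp
    rw [this]
    simp
  | succ K ih =>
    have hle : β ≤ β * 2 ^ K := Nat.le_mul_of_pos_right _ (by positivity)
    have hpow : β * 2 ^ (K + 1) = 2 * (β * 2 ^ K) := by ring
    have h1 := processLaw_real_phase_le s (hβ.trans hle) (by omega : _ ≤ n) t₀
    have h2 := ih (by omega) (t₀ + (80 * (β * 2 ^ K) + 1))
    have h3 : Real.exp (-(((β * 2 ^ K : ℕ) : ℝ) / 5)) ≤ Real.exp (-((β : ℝ) / 5)) := by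
      have : (β : ℝ) ≤ ((β * 2 ^ K : ℕ) : ℝ) := by exact_mod_cast hle
      rw [Real.exp_le_exp]
      linarith
    refine le_trans ?_ ((measureReal_union_le _ _).trans
      ((add_le_add (h1.trans h3) h2).trans (le_of_eq ?_)))
    · refine measureReal_mono ?_
      rintro x ⟨hx1, hx2⟩
      rw [hpow] at hx1
      rw [Finset.sum_range_succ, add_comm (∑ j ∈ Finset.range K, _), ← add_assoc] at hx2
      by_cases h : (β * 2 ^ K) ^ 2 < unburntCard x (t₀ + (80 * (β * 2 ^ K) + 1))
      · exact Or.inl ⟨hx1, h⟩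
      · exact Or.inr ⟨not_lt.1 h, hx2⟩
    · push_cast
      ring

/-- The fire needs at most `M` further rounds once at most `M` vertices are unburnt. -/
lemma burning_eq_univ_of_unburntCard_le {x : ℕ → Fin (n + 1)} {t M : ℕ} (hM : M ≤ n)
    (h : unburntCard x t ≤ M) :
    burning (SimpleGraph.pathGraph (n + 1)) x (t + M) = Set.univ := by
  refine Set.eq_univ_of_forall fun v => by_contra fun hv => ?_
  have h1 : (near M v : Set (Fin (n + 1))) ⊆
      (burning (SimpleGraph.pathGraph (n + 1)) x t)ᶜ :=
    fun w hw => not_mem_burning_of_mem_near hv (Finset.mem_coe.1 hw)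
  have h2 := Set.ncard_le_ncard h1 (Set.toFinite _)
  rw [Set.ncard_coe_finset] at h2
  have h3 := succ_le_card_near hM v
  rw [unburntCard] at h
  omega

lemma processLaw_real_pool₃_lt_burningTime_le (s : Timing) {β K : ℕ} (hβ : 41 ≤ β)
    (hn : 20 * (β * 2 ^ K) ≤ n) (hβn : β ^ 2 ≤ n) (hK : n + 1 ≤ (β * 2 ^ K) ^ 2) :
    (processLaw (pool₃ s (SimpleGraph.pathGraph (n + 1)))).real
      {x | 80 * (β * 2 ^ K) + K + β ^ 2 < burningTime (SimpleGraph.pathGraph (n + 1)) x} ≤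
      K * Real.exp (-((β : ℝ) / 5)) := by
  refine le_trans ?_ (processLaw_real_phases_le s hβ K hn 0)
  refine measureReal_mono fun x hx => ⟨?_, ?_⟩
  · refine le_trans ?_ hK
    have := Set.ncard_le_card (burning (SimpleGraph.pathGraph (n + 1)) x 0)ᶜ
    rwa [Nat.card_eq_fintype_card, Fintype.card_fin] at this
  · by_contra! h
    have h1 := (burningTime_le_iff _ _).2 (burning_eq_univ_of_unburntCard_le hβn h)
    have h2 : ∑ j ∈ Finset.range K, (80 * (β * 2 ^ j) + 1) ≤ 80 * (β * 2 ^ K) + K := by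
      have h3 : ∑ j ∈ Finset.range K, 2 ^ j ≤ 2 ^ K := by
        have := Nat.geomSum_lt (m := 2) (n := K) (s := Finset.range K) le_rfl
          fun k hk => Finset.mem_range.1 hk
        exact this.le
      rw [Finset.sum_add_distrib, ← Finset.mul_sum, ← Finset.mul_sum]
      simp only [Finset.sum_const, Finset.card_range, smul_eq_mul, mul_one]
      gcongr
    simp only [Set.mem_ofPred_eq] at hx
    omega

/-- A.a.s. the burning time of the third process is at most `186 √N`. -/
lemma tendsto_processLaw_real_pool₃ (s : Timing) :
    Tendsto (fun n : ℕ => (processLaw (pool₃ s (SimpleGraph.pathGraph (n + 1)))).real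
      {x | 186 * √((n + 1 : ℕ) : ℝ) <
        (burningTime (SimpleGraph.pathGraph (n + 1)) x : ℝ)}) atTop (𝓝 0) := by
  -- Thus `P = 2 ^ K` lies between `N ^ (1/4) / 2` and `N ^ (1/4)`. With `β = ⌈√N / P⌉` the initial
  -- scale `β P` is about `√N`, while the final scale `β` is of order `N ^ (1/4)`: `β²` is still
  -- `O(√N)`, yet `K exp (-(β / 5))` vanishes.
  let K : ℕ → ℕ := fun n => Nat.log 2 (n + 1) / 4
  have hlow : ∀ n, ((2 : ℝ) ^ K n) ^ 4 ≤ ((n + 1 : ℕ) : ℝ) := by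
    intro n
    have h1 : (2 ^ K n) ^ 4 ≤ n + 1 := by
      rw [← pow_mul]
      exact (Nat.pow_le_pow_right two_pos (Nat.div_mul_le_self _ _)).trans
        (Nat.pow_log_le_self 2 (Nat.succ_ne_zero n))
    exact_mod_cast h1
  have hup : ∀ n, ((n + 1 : ℕ) : ℝ) ≤ 16 * ((2 : ℝ) ^ K n) ^ 4 := by
    intro n
    have h1 : n + 1 ≤ 16 * (2 ^ K n) ^ 4 := by
      have h2 := Nat.lt_pow_succ_log_self one_lt_two (n + 1)
      have h3 : 16 * (2 ^ K n) ^ 4 = 2 ^ (K n * 4 + 4) := by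
        rw [pow_add, pow_mul, mul_comm]
        norm_num
      rw [h3]
      exact h2.le.trans (Nat.pow_le_pow_right two_pos (by simp only [K]; omega))
    exact_mod_cast h1
  have hP : Tendsto (fun n => (2 : ℝ) ^ K n) atTop atTop := by
    refine tendsto_atTop.2 fun M => ?_
    filter_upwards [tendsto_natCast_succ_atTop.eventually_gt_atTop (16 * |M| ^ 4)] with n hn
    by_contra! h
    have h1 := pow_le_pow_left₀ (by positivity) (h.le.trans (le_abs_self M)) 4
    linarith [hup n]
  have hlim : Tendsto (fun n => (2 : ℝ) ^ K n * Real.exp (-((2 : ℝ) ^ K n / 5)))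
      atTop (𝓝 0) := by
    have h := (Real.tendsto_pow_mul_exp_neg_atTop_nhds_zero 1).comp
      (hP.atTop_div_const (by norm_num : (0 : ℝ) < 5))
    have h2 := h.const_mul 5
    rw [mul_zero] at h2
    refine h2.congr fun n => ?_
    simp only [Function.comp, pow_one]
    ring
  refine squeeze_zero' (Eventually.of_forall fun n => measureReal_nonneg) ?_ hlim
  filter_upwards [hP.eventually_ge_atTop 41] with n hn
  have hlow := hlow n
  have hup := hup n
  set P : ℝ := (2 : ℝ) ^ K n with hPdef
  set R := √((n + 1 : ℕ) : ℝ)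
  have hR : R ^ 2 = ((n + 1 : ℕ) : ℝ) := Real.sq_sqrt (Nat.cast_nonneg _)
  have hR0 : 0 ≤ R := Real.sqrt_nonneg _
  have hP0 : 0 < P := by linarith
  have hPR : P ^ 2 ≤ R := by
    refine (pow_le_pow_iff_left₀ (by positivity) hR0 two_ne_zero).1 ?_
    rw [hR]
    linarith
  have hRP : R ≤ 4 * P ^ 2 := by
    refine (pow_le_pow_iff_left₀ hR0 (by positivity) two_ne_zero).1 ?_
    rw [hR]
    linarith
  set β := ⌈R / P⌉₊
  have hβ1 : R / P ≤ β := Nat.le_ceil _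
  have hβ2 : (β : ℝ) < R / P + 1 := Nat.ceil_lt_add_one (by positivity)
  have hβP1 : R ≤ β * P := (div_le_iff₀ hP0).1 hβ1
  have hβP2 : β * P ≤ R + P := by
    have := mul_le_mul_of_nonneg_right hβ2.le hP0.le
    rwa [add_mul, div_mul_cancel₀ _ hP0.ne', one_mul] at this
  have hPβ : P ≤ β := by nlinarith
  have hβ5 : (β : ℝ) ≤ 5 * P := by nlinarith
  have hKP : (K n : ℝ) ≤ P := by
    have := (Nat.lt_two_pow_self (n := K n)).le
    rw [hPdef]
    exact_mod_cast this
  have hPP : P ≤ P ^ 2 := by nlinarith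
  have hR41 : 41 * 41 ≤ R := by nlinarith
  have hnR : R ^ 2 = n + 1 := by
    rw [hR]
    push_cast
    ring
  have c1 : 41 ≤ β := by exact_mod_cast hn.trans hPβ
  have c2 : 20 * (β * 2 ^ K n) ≤ n := by
    have : (20 : ℝ) * (β * P) ≤ n := by nlinarith
    rw [hPdef] at this
    exact_mod_cast this
  have hβsq : (β : ℝ) ^ 2 ≤ 25 * R := by
    have := pow_le_pow_left₀ (Nat.cast_nonneg β) hβ5 2
    nlinarith
  have c3 : β ^ 2 ≤ n := by
    have : (β : ℝ) ^ 2 ≤ n := by nlinarith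
    exact_mod_cast this
  have c4 : n + 1 ≤ (β * 2 ^ K n) ^ 2 := by
    have h1 := pow_le_pow_left₀ hR0 hβP1 2
    rw [hR, hPdef] at h1
    exact_mod_cast h1
  refine (measureReal_mono fun x hx => ?_).trans
    ((processLaw_real_pool₃_lt_burningTime_le s c1 c2 c3 c4).trans ?_)
  · simp only [Set.mem_ofPred_eq] at hx ⊢
    -- The constant comes from `80 (R + P) + P + 25 R ≤ 186 R`, using `P ≤ P² ≤ R`.
    have h1 : (80 : ℝ) * (β * P) + K n + (β : ℝ) ^ 2 <
        burningTime (SimpleGraph.pathGraph (n + 1)) x := by linarith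
    rw [hPdef] at h1
    exact_mod_cast h1
  · refine mul_le_mul hKP (Real.exp_le_exp.2 (by linarith)) (Real.exp_nonneg _) hP0.le

end Phases

/-! ### Transfer to arbitrary probability spaces and to the cost of drunkenness -/

section Transfer

variable {Ω : ℕ → Type*}

lemma sqrt_le_bPath (X : ∀ n, Ω n → ℕ → Fin (n + 1)) (n : ℕ) (ω : Ω n) :
    √((n + 1 : ℕ) : ℝ) ≤ bPath X n ω :=
  sqrt_le_of_le_sq (le_sq_burningTime _)

variable [∀ n, MeasurableSpace (Ω n)]

/-- Subadditivity alone is used, so the events need not be measurable. -/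
lemma aas_of_tendsto_compl {P : ∀ n, Measure (Ω n)} [∀ n, IsProbabilityMeasure (P n)]
    {E : ∀ n, Set (Ω n)} (h : Tendsto (fun n => P n (E n)ᶜ) atTop (𝓝 0)) : AAS P E := by
  have h1 : Tendsto (fun n => 1 - P n (E n)ᶜ) atTop (𝓝 1) := by
    simpa using ENNReal.Tendsto.sub tendsto_const_nhds h (Or.inl ENNReal.one_ne_top)
  refine tendsto_of_tendsto_of_tendsto_of_le_of_le h1 tendsto_const_nhds (fun n => ?_)
    fun n => prob_le_one
  rw [tsub_le_iff_right]
  calc (1 : ENNReal) = P n (E n ∪ (E n)ᶜ) := by rw [Set.union_compl_self, measure_univ]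
    _ ≤ _ := measure_union_le _ _

/-- For every `ε > 0`, the probability that `A` deviates from `B` by more than `ε B` tends
to `0`. -/
def NegligibleDeviation (P : ∀ n, Measure (Ω n)) (A : ∀ n, Ω n → ℝ) (B : ℕ → ℝ) : Prop :=
  ∀ ε : ℝ, 0 < ε → Tendsto (fun n => P n {ω | ε * B n < |A n ω - B n|}) atTop (𝓝 0)

lemma NegligibleDeviation.aasEquiv {P : ∀ n, Measure (Ω n)} [∀ n, IsProbabilityMeasure (P n)]
    {A : ∀ n, Ω n → ℝ} {B : ℕ → ℝ} (h : NegligibleDeviation P A B) :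
    AASEquiv P A (fun n _ => B n) := by
  intro ε hε
  refine aas_of_tendsto_compl ((h ε hε).congr fun n => ?_)
  congr 1
  ext ω
  simp

lemma NegligibleDeviation.aasEquiv_of_both {P : ∀ n, Measure (Ω n)}
    [∀ n, IsProbabilityMeasure (P n)] {A A' : ∀ n, Ω n → ℝ} {B : ℕ → ℝ}
    (h : NegligibleDeviation P A B) (h' : NegligibleDeviation P A' B) : AASEquiv P A A' := by
  intro ε hε
  -- The solution `δ` of `2 δ = ε (1 - δ)`: two deviations of `δ B` are then at most `ε A'`, because
  -- `A' ≥ (1 - δ) B`.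
  have hδ : 0 < ε / (2 + ε) := by positivity
  have hlim := (h _ hδ).add (h' _ hδ)
  rw [add_zero] at hlim
  refine aas_of_tendsto_compl (tendsto_of_tendsto_of_tendsto_of_le_of_le tendsto_const_nhds hlim
    (fun n => zero_le) fun n => (measure_mono fun ω hω => ?_).trans (measure_union_le _ _))
  by_contra hcon
  simp only [Set.mem_union, Set.mem_ofPred_eq, not_or, not_lt] at hcon
  refine hω ?_
  change |A n ω - A' n ω| ≤ ε * A' n ω
  have h1 := abs_le.1 hcon.1
  have h2 := abs_le.1 hcon.2
  have h3 : ε / (2 + ε) * B n * 2 = ε * (B n - ε / (2 + ε) * B n) := by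
    field_simp
    ring
  have h4 := mul_le_mul_of_nonneg_left (by linarith : B n - ε / (2 + ε) * B n ≤ A' n ω) hε.le
  exact abs_le.2 ⟨by linarith, by linarith⟩

lemma NegligibleDeviation.div {P : ∀ n, Measure (Ω n)} {A : ∀ n, Ω n → ℝ} {B C D R : ℕ → ℝ}
    (h : NegligibleDeviation P A B) (hB : ∀ n, B n = C n * R n) (hC : ∀ n, 0 ≤ C n)
    (hD : ∀ n, 0 < D n) (hRD : ∀ n, R n ≤ D n)
    (hlim : Tendsto (fun n => R n / D n) atTop (𝓝 1)) :
    NegligibleDeviation P (fun n ω => A n ω / D n) C := by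
  intro ε hε
  refine tendsto_of_tendsto_of_tendsto_of_le_of_le' tendsto_const_nhds (h (ε / 2) (half_pos hε))
    (Eventually.of_forall fun n => zero_le) ?_
  filter_upwards [hlim.eventually_const_le (by linarith : 1 - ε / 2 < 1)] with n hn
  refine measure_mono fun ω hω => ?_
  by_contra hcon
  simp only [Set.mem_ofPred_eq, not_lt] at hcon hω
  refine not_le.2 hω ?_
  have hr1 : R n / D n ≤ 1 := (div_le_one (hD n)).2 (hRD n)
  have h1 : A n ω / D n - C n = (A n ω - B n) / D n + C n * (R n / D n - 1) := by
    rw [hB]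
    ring
  have h2 : |(A n ω - B n) / D n| ≤ ε / 2 * C n := by
    rw [abs_div, abs_of_pos (hD n)]
    calc |A n ω - B n| / D n ≤ ε / 2 * B n / D n := div_le_div_of_nonneg_right hcon (hD n).le
      _ = ε / 2 * C n * (R n / D n) := by rw [hB]; ring
      _ ≤ ε / 2 * C n := mul_le_of_le_one_right (mul_nonneg (half_pos hε).le (hC n)) hr1
  have h3 : |C n * (R n / D n - 1)| ≤ ε / 2 * C n := by
    rw [abs_mul, abs_of_nonneg (hC n), mul_comm]
    exact mul_le_mul_of_nonneg_right (abs_le.2 ⟨by linarith, by linarith⟩) (hC n)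
  rw [h1]
  linarith [abs_add_le ((A n ω - B n) / D n) (C n * (R n / D n - 1))]

/-- The preimage of any set has at most the measure its image law gives, so `S n` may be
non-measurable. -/
lemma tendsto_measure_preimage {P : ∀ n, Measure (Ω n)} {X : ∀ n, Ω n → ℕ → Fin (n + 1)}
    {pool : ∀ n, (ℕ → Fin (n + 1)) → ℕ → Set (Fin (n + 1))}
    (hX : ∀ n, HasLaw (X n) (processLaw (pool n)) (P n)) {S : ∀ n, Set (ℕ → Fin (n + 1))}
    (h : Tendsto (fun n => (processLaw (pool n)).real (S n)) atTop (𝓝 0)) :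
    Tendsto (fun n => P n (X n ⁻¹' S n)) atTop (𝓝 0) := by
  have h1 : Tendsto (fun n => processLaw (pool n) (S n)) atTop (𝓝 0) := by
    have := ENNReal.tendsto_ofReal h
    rw [ENNReal.ofReal_zero] at this
    exact this.congr fun n => ofReal_measureReal
  refine tendsto_of_tendsto_of_tendsto_of_le_of_le tendsto_const_nhds h1 (fun n => zero_le)
    fun n => ?_
  change P n (X n ⁻¹' S n) ≤ processLaw (pool n) (S n)
  rw [← (hX n).map_eq]
  exact Measure.le_map_apply (hX n).aemeasurable _

lemma negligibleDeviation_bPath {P : ∀ n, Measure (Ω n)} {X : ∀ n, Ω n → ℕ → Fin (n + 1)}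
    {pool : ∀ n, (ℕ → Fin (n + 1)) → ℕ → Set (Fin (n + 1))}
    (hX : ∀ n, HasLaw (X n) (processLaw (pool n)) (P n)) (hp : ∀ n, IsBallPool (pool n))
    (hcard : ∀ n x t, n + 1 ≤ (pool n x t).ncard + t) :
    NegligibleDeviation P (bPath X) uniformScale := by
  intro ε hε
  have hlim := (tendsto_measure_preimage hX (tendsto_processLaw_real_lt_burningTime hp hε)).add
    (tendsto_measure_preimage hX (tendsto_processLaw_real_burningTime_lt hp hcard hε))
  rw [add_zero] at hlim
  refine tendsto_of_tendsto_of_tendsto_of_le_of_le tendsto_const_nhds hlim (fun n => zero_le)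
    fun n => (measure_mono fun ω hω => ?_).trans (measure_union_le _ _)
  have hω : ε * uniformScale n < |bPath X n ω - uniformScale n| := hω
  rcases lt_abs.1 hω with h | h
  · left
    simp only [Set.mem_preimage, Set.mem_ofPred_eq]
    change _ < bPath X n ω
    linarith
  · right
    simp only [Set.mem_preimage, Set.mem_ofPred_eq]
    change bPath X n ω < _
    linarith

lemma one_le_sqrt_succ (n : ℕ) : 1 ≤ √((n + 1 : ℕ) : ℝ) :=
  Real.one_le_sqrt.2 (by exact_mod_cast Nat.succ_le_succ (Nat.zero_le n))

lemma burningNumber_pos (s : Timing) (n : ℕ) :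
    (0 : ℝ) < burningNumber s (SimpleGraph.pathGraph (n + 1)) :=
  zero_lt_one.trans_le ((one_le_sqrt_succ n).trans (sqrt_le_burningNumber s n))

lemma tendsto_sqrt_div_burningNumber (s : Timing) :
    Tendsto (fun n : ℕ => √((n + 1 : ℕ) : ℝ) /
      (burningNumber s (SimpleGraph.pathGraph (n + 1)) : ℝ)) atTop (𝓝 1) := by
  have hs : Tendsto (fun n : ℕ => √((n + 1 : ℕ) : ℝ)) atTop atTop :=
    Real.tendsto_sqrt_atTop.comp tendsto_natCast_succ_atTop
  have h1 : Tendsto (fun n : ℕ => 1 - (√((n + 1 : ℕ) : ℝ))⁻¹) atTop (𝓝 1) := by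
    simpa using tendsto_const_nhds.sub hs.inv_tendsto_atTop
  refine tendsto_of_tendsto_of_tendsto_of_le_of_le h1 tendsto_const_nhds (fun n => ?_)
    fun n => (div_le_one (burningNumber_pos s n)).2 (sqrt_le_burningNumber s n)
  have hR := one_le_sqrt_succ n
  have hD := burningNumber_le_sqrt_add_one s n
  set R := √((n + 1 : ℕ) : ℝ)
  have hR0 : 0 < R := by linarith
  change 1 - R⁻¹ ≤ R / _
  rw [le_div_iff₀ (burningNumber_pos s n)]
  have hinv : R⁻¹ ≤ 1 := inv_le_one_of_one_le₀ hR
  calc (1 - R⁻¹) * (burningNumber s (SimpleGraph.pathGraph (n + 1)) : ℝ)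
      ≤ (1 - R⁻¹) * (R + 1) := mul_le_mul_of_nonneg_left hD (by linarith)
    _ = R - R⁻¹ := by field_simp; ring
    _ ≤ R := by linarith [inv_pos.2 hR0]

lemma NegligibleDeviation.cPath {P : ∀ n, Measure (Ω n)} {X : ∀ n, Ω n → ℕ → Fin (n + 1)}
    (h : NegligibleDeviation P (bPath X) uniformScale) (s : Timing) :
    NegligibleDeviation P (cPath s X) fun n => √(Real.log ((n + 1 : ℕ) : ℝ) / 2) := by
  refine h.div (fun n => ?_) (fun n => Real.sqrt_nonneg _) (burningNumber_pos s)
    (sqrt_le_burningNumber s) (tendsto_sqrt_div_burningNumber s)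
  rw [uniformScale, ← Real.sqrt_mul (div_nonneg (log_succ_nonneg n) zero_le_two)]
  congr 1
  ring

lemma tendsto_lt_bPath₃ {P : ∀ n, Measure (Ω n)} {X : ∀ n, Ω n → ℕ → Fin (n + 1)} {s : Timing}
    (hX : ∀ n, HasLaw (X n) (processLaw (pool₃ s (SimpleGraph.pathGraph (n + 1)))) (P n)) :
    Tendsto (fun n => P n {ω | 186 * √((n + 1 : ℕ) : ℝ) < bPath X n ω}) atTop (𝓝 0) :=
  tendsto_measure_preimage hX (tendsto_processLaw_real_pool₃ s)

end Transfer

end Burning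

theorem theorem1p4 (s : Burning.Timing)
    {Ω : ℕ → Type*} [∀ n, MeasurableSpace (Ω n)]
    (P : ∀ n, Measure (Ω n)) [∀ n, IsProbabilityMeasure (P n)]
    (X₁ X₂ X₃ : ∀ n, Ω n → ℕ → Fin (n + 1))
    (hX₁ : ∀ n, HasLaw (X₁ n) (Burning.processLaw Burning.pool₁) (P n))
    (hX₂ : ∀ n, HasLaw (X₂ n) (Burning.processLaw Burning.pool₂) (P n))
    (hX₃ : ∀ n, HasLaw (X₃ n)
      (Burning.processLaw (Burning.pool₃ s (SimpleGraph.pathGraph (n + 1)))) (P n)) :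
    (Burning.AASEquiv P (Burning.bPath X₁) (Burning.bPath X₂) ∧
      Burning.AASEquiv P (Burning.bPath X₁)
        (fun n _ => √(((n + 1 : ℕ) : ℝ) * Real.log ((n + 1 : ℕ) : ℝ) / 2)) ∧
      Burning.AASEquiv P (Burning.bPath X₂)
        (fun n _ => √(((n + 1 : ℕ) : ℝ) * Real.log ((n + 1 : ℕ) : ℝ) / 2)) ∧
      Burning.AASEquiv P (Burning.cPath s X₁) (Burning.cPath s X₂) ∧
      Burning.AASEquiv P (Burning.cPath s X₁)
        (fun n _ => √(Real.log ((n + 1 : ℕ) : ℝ) / 2)) ∧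
      Burning.AASEquiv P (Burning.cPath s X₂)
        (fun n _ => √(Real.log ((n + 1 : ℕ) : ℝ) / 2))) ∧
    (Burning.AASTheta P (Burning.bPath X₃) (fun n _ => √((n + 1 : ℕ) : ℝ)) ∧
      Burning.AASTheta P (Burning.cPath s X₃) (fun _ _ => 1)) := by
  have h₁ := Burning.negligibleDeviation_bPath hX₁ (fun _ => Burning.isBallPool_pool₁)
    fun _ => Burning.le_ncard_pool₁
  have h₂ := Burning.negligibleDeviation_bPath hX₂ (fun _ => Burning.isBallPool_pool₂)
    fun _ => Burning.le_ncard_pool₂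
  have h₃ := Burning.tendsto_lt_bPath₃ hX₃
  refine ⟨⟨h₁.aasEquiv_of_both h₂, h₁.aasEquiv, h₂.aasEquiv,
    (h₁.cPath s).aasEquiv_of_both (h₂.cPath s), (h₁.cPath s).aasEquiv, (h₂.cPath s).aasEquiv⟩,
    ⟨1, 186, by norm_num, by norm_num, ?_⟩, ⟨1 / 2, 186, by norm_num, by norm_num, ?_⟩⟩ <;>
  refine Burning.aas_of_tendsto_compl (tendsto_of_tendsto_of_tendsto_of_le_of_le
    tendsto_const_nhds h₃ (fun n => zero_le) fun n => measure_mono fun ω hω => ?_) <;>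
  by_contra hcon <;> refine hω ?_ <;> simp only [Set.mem_ofPred_eq, not_lt] at hcon ⊢
  · exact ⟨by linarith [Burning.sqrt_le_bPath X₃ n ω], hcon⟩
  -- The constant `1 / 2` comes from bounding the burning number by `√N + 1 ≤ 2 √N`; the `186`
  -- survives because the burning number is at least `√N`.
  · have hb := Burning.sqrt_le_bPath X₃ n ω
    have hR := Burning.one_le_sqrt_succ n
    have h1 := Burning.sqrt_le_burningNumber s n
    have h2 := Burning.burningNumber_le_sqrt_add_one s n
    rw [Burning.cPath, le_div_iff₀ (Burning.burningNumber_pos s n),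
      div_le_iff₀ (Burning.burningNumber_pos s n)]
    constructor <;> linarith
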